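/- Let $n\in\mathbb N$, let $a<b$ be real numbers, and put $\mathcal J=\begin{pmatrix}0&I\\-I&0\end{pmatrix}\in\mathbb R^{2n\times 2n}$ and $E=\begin{pmatrix}0\\I\end{pmatrix}\in\mathbb R^{2n\times n}$. A continuous Lagrangian path on $[a,b]$ is a continuous function $Y=\begin{pmatrix}X\\U\end{pmatrix}:[a,b]\to\mathbb R^{2n\times n}$ (with $n\times n$ blocks $X$, $U$) such that $Y^T(t)\mathcal JY(t)=0$ and $\operatorname{rank}Y(t)=n$ for all $t\in[a,b]$; the constant path $E$ is the vertical one. A matrix $R\in\mathbb R^{2n\times 2n}$ is symplectic if $R^T\mathcal JR=\mathcal J$. *Comparative index.* For constant $Y=\begin{pmatrix}X\\U\end{pmatrix}$ and $\hat Y=\begin{pmatrix}\hat X\\\hat U\end{pmatrix}$ as above let $W(Y,\hat Y)=Y^T\mathcal J\hat Y$, $\mathcal M=(I-X^\dagger X)\,W(Y,\hat Y)$, $V=I-\mathcal M^\dagger\mathcal M$, $\mathcal P=V\,W(Y,\hat Y)^TX^\dagger\hat X\,V$, where $\dagger$ is the Moore–Penrose pseudoinverse, and let $\mu(Y,\hat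 Y)=\operatorname{rank}\mathcal M+\operatorname{ind}\mathcal P$, where $\operatorname{ind}\mathcal P$ is the number of negative eigenvalues of the symmetric matrix $\mathcal P$, counted with multiplicity. *Oscillation number.* For a continuous Lagrangian path $Y$ on $[a,b]$ consider partitions $D=\{a=t_0<t_1<\dots<t_p=b\}$ together with symplectic matrix functions $R=\{R_k(t)\}_{k=0}^{p-1}$ on $[a,b]$ such that, for every $k$, on the interval $[t_k,t_{k+1}]$ the function $R_k$ is continuous and the ranks of $W(R_k(t)E,Y(t))$ and of the upper $n\times n$ block of $R_k(t)E$ are constant. Put $$\mathcal N(Y,D,R)=\sum_{k=0}^{p-1}\Big(\mu\big(Y(t_{k+1}),R_k(t_{k+1})E\big)-\mu\big(Y(t_k),R_k(t_k)E\big)\Big).$$ The oscillation number $\mathcal N(Y)$ of $Y$ on $[a,b]$ is the common value of $\mathcal N(Y,D,R)$ for all such pairs $(D,R)$. *Maslov index.* For continuous Lagrangian paths $Y=\begin{pmatrix}X\\U\end{pmatrix}$, $\hat Y=\begin{pmatrix}\hat X\\\hat U\end{pmatrix}$ on $[a,b]$ let $$\Gamma(t)=-[X(t)+iU(t)]\,[X(t)-iU(t)]^{-1}\,[\hat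 X(t)-i\hat U(t)]\,[\hat X(t)+i\hat U(t)]^{-1}.$$ Consider partitions $\{a=t_0<t_1<\dots<t_p=b\}$ together with numbers $\varepsilon_k\in(0,\pi)$, $k=1,\dots,p$, such that for every $k$ neither of the numbers $e^{i(\pi\pm\varepsilon_k)}$ is an eigenvalue of $\Gamma(t)$ for any $t\in[t_{k-1},t_k]$, and put $$\ell(t,\varepsilon_k)=\sum_{\theta\in[0,\varepsilon_k)}\dim\ker\big(\Gamma(t)-e^{i(\pi+\theta)}I\big).$$ The Maslov index $\operatorname{Mas}(Y,\hat Y;[a,b])$ is the common value of $\sum_{k=1}^p\big(\ell(t_k,\varepsilon_k)-\ell(t_{k-1},\varepsilon_k)\big)$ for all such choices of the partition and of the $\varepsilon_k$. **Corollary.** Let $Y$ be a continuous Lagrangian path on $[a,b]$. Then $\mathcal N(Y)$ and $\operatorname{Mas}(E,Y;[a,b])$ are well defined (admissible choices exist, and the values do not depend on them), and $$\mathcal N(Y)=\operatorname{Mas}(E,Y;[a,b]).$$ -/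

import Mathlib

open Matrix

namespace LagrangianPaths

noncomputable section

/-! Real `2n × n` and `2n × 2n` matrices are indexed by `Fin n ⊕ Fin n`, the left summand being the
upper and the right summand the lower block. -/

/-- The upper block `X` of `Y = (Xᵀ, Uᵀ)ᵀ`. -/
def upper {n : ℕ} (Y : Matrix (Fin n ⊕ Fin n) (Fin n) ℝ) : Matrix (Fin n) (Fin n) ℝ :=
  Y.toRows₁

/-- The lower block `U` of `Y = (Xᵀ, Uᵀ)ᵀ`. -/
def lower {n : ℕ} (Y : Matrix (Fin n ⊕ Fin n) (Fin n) ℝ) : Matrix (Fin n) (Fin n) ℝ :=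
  Y.toRows₂

/-- The canonical skew-symmetric matrix `[[0, I], [-I, 0]]`. It is the negative of Mathlib's
`Matrix.J`, which defines the same symplectic group. -/
def canonicalJ (n : ℕ) : Matrix (Fin n ⊕ Fin n) (Fin n ⊕ Fin n) ℝ :=
  Matrix.fromBlocks 0 1 (-1) 0

/-- The matrix `E = (0 I)ᵀ`, representing the vertical Lagrangian plane. -/
def vertical (n : ℕ) : Matrix (Fin n ⊕ Fin n) (Fin n) ℝ :=
  Matrix.fromRows 0 1

/-- The Wronskian `W(Y, Z) = Yᵀ 𝒥 Z`. -/
def wronskian {n : ℕ} (Y Z : Matrix (Fin n ⊕ Fin n) (Fin n) ℝ) : Matrix (Fin n) (Fin n) ℝ :=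
  Yᵀ * canonicalJ n * Z

/-- `Yᵀ 𝒥 Y = 0` and `rank Y = n`. -/
def IsLagrangian {n : ℕ} (Y : Matrix (Fin n ⊕ Fin n) (Fin n) ℝ) : Prop :=
  Yᵀ * canonicalJ n * Y = 0 ∧ Y.rank = n

/-- Continuous Lagrangian paths on `[a, b]`. -/
structure IsLagrangianPath {n : ℕ} (a b : ℝ)
    (Y : ℝ → Matrix (Fin n ⊕ Fin n) (Fin n) ℝ) : Prop where
  continuousOn : ContinuousOn Y (Set.Icc a b)
  isLagrangian : ∀ t ∈ Set.Icc a b, IsLagrangian (Y t)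

/-! ### The Moore–Penrose pseudoinverse -/

/-- The four Penrose equations: `B` is the Moore–Penrose pseudoinverse of `A`. -/
structure IsMoorePenrose {n : ℕ} (A B : Matrix (Fin n) (Fin n) ℝ) : Prop where
  mul_mul_self : A * B * A = A
  mul_mul_inv : B * A * B = B
  symm_left : (A * B)ᵀ = A * B
  symm_right : (B * A)ᵀ = B * A

theorem IsMoorePenrose.unique {n : ℕ} {A B C : Matrix (Fin n) (Fin n) ℝ}
    (hB : IsMoorePenrose A B) (hC : IsMoorePenrose A C) : B = C := by
  have h1 : A * B = A * C := by
    calc A * B = (A * B)ᵀ := hB.symm_left.symm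
      _ = ((A * C) * (A * B))ᵀ := by rw [← Matrix.mul_assoc (A * C), hC.mul_mul_self]
      _ = (A * B) * (A * C) := by rw [transpose_mul, hB.symm_left, hC.symm_left]
      _ = A * C := by rw [← Matrix.mul_assoc (A * B), hB.mul_mul_self]
  have h2 : B * A = C * A := by
    calc B * A = (B * A)ᵀ := hB.symm_right.symm
      _ = ((B * A) * (C * A))ᵀ := by
          rw [Matrix.mul_assoc B A (C * A), ← Matrix.mul_assoc A C A, hC.mul_mul_self]
      _ = (C * A) * (B * A) := by rw [transpose_mul, hB.symm_right, hC.symm_right]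
      _ = C * A := by
          rw [Matrix.mul_assoc C A (B * A), ← Matrix.mul_assoc A B A, hB.mul_mul_self]
  calc B = B * A * B := hB.mul_mul_inv.symm
    _ = C * A * C := by rw [h2, Matrix.mul_assoc, h1, ← Matrix.mul_assoc]
    _ = C := hC.mul_mul_inv

theorem exists_isMoorePenrose {n : ℕ} (A : Matrix (Fin n) (Fin n) ℝ) :
    ∃ B, IsMoorePenrose A B := by
  -- a symmetric `G` which is the pseudoinverse of `H = AᵀA`
  obtain ⟨G, hGt, hHGH, hGHG, hsym⟩ : ∃ G : Matrix (Fin n) (Fin n) ℝ, Gᵀ = G ∧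
      (Aᵀ * A) * G * (Aᵀ * A) = Aᵀ * A ∧ G * (Aᵀ * A) * G = G ∧
      (G * (Aᵀ * A))ᵀ = G * (Aᵀ * A) := by
    have hH : (Aᵀ * A).IsHermitian := by
      simpa using Matrix.isHermitian_conjTranspose_mul_self A
    obtain ⟨U, V, d, hVU, hVt, hUD⟩ : ∃ (U V : Matrix (Fin n) (Fin n) ℝ) (d : Fin n → ℝ),
        V * U = 1 ∧ V = Uᵀ ∧ Aᵀ * A = U * diagonal d * V := by
      refine ⟨(hH.eigenvectorUnitary : Matrix (Fin n) (Fin n) ℝ),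
        star (hH.eigenvectorUnitary : Matrix (Fin n) (Fin n) ℝ), hH.eigenvalues, ?_, ?_, ?_⟩
      · exact Unitary.coe_star_mul_self hH.eigenvectorUnitary
      · simp [star_eq_conjTranspose]
      · have := hH.spectral_theorem
        simpa [Unitary.conjStarAlgAut_apply, Function.comp_def] using this
    have key : ∀ e f : Fin n → ℝ,
        (U * diagonal e * V) * (U * diagonal f * V) = U * diagonal (fun i => e i * f i) * V := by
      intro e f
      calc (U * diagonal e * V) * (U * diagonal f * V)
          = U * diagonal e * (V * U) * diagonal f * V := by simp only [Matrix.mul_assoc]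
        _ = _ := by
          rw [hVU, Matrix.mul_one, Matrix.mul_assoc U, diagonal_mul_diagonal]
    have ht : ∀ e : Fin n → ℝ, (U * diagonal e * V)ᵀ = U * diagonal e * V := by
      intro e
      rw [hVt]
      simp [transpose_mul, Matrix.mul_assoc]
    refine ⟨U * diagonal (fun i => (d i)⁻¹) * V, ht _, ?_, ?_, ?_⟩
    · rw [hUD, key, key]
      congr 3
      funext i
      by_cases h : d i = 0 <;> simp [h]
    · rw [hUD, key, key]
      congr 3
      funext i
      by_cases h : d i = 0 <;> simp [h]
    · rw [hUD, key, ht]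
  refine ⟨G * Aᵀ, ?_, ?_, ?_, ?_⟩
  · have hz : (A * G * Aᵀ * A - A)ᵀ * (A * G * Aᵀ * A - A) = 0 := by
      have e1 : (A * G * Aᵀ * A - A)ᵀ = Aᵀ * A * G * Aᵀ - Aᵀ := by
        simp [transpose_mul, hGt, Matrix.mul_assoc]
      have e2 : (Aᵀ * A * G * Aᵀ - Aᵀ) * (A * G * Aᵀ * A - A)
          = ((Aᵀ * A) * G * (Aᵀ * A)) * G * (Aᵀ * A) - (Aᵀ * A) * G * (Aᵀ * A)
            - ((Aᵀ * A) * G * (Aᵀ * A) - Aᵀ * A) := by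
        noncomm_ring
      rw [e1, e2, hHGH, hHGH]
      simp
    have hz' : (A * G * Aᵀ * A - A)ᴴ * (A * G * Aᵀ * A - A) = 0 := by simpa using hz
    have := Matrix.conjTranspose_mul_self_eq_zero.mp hz'
    rw [← Matrix.mul_assoc]
    exact sub_eq_zero.mp this
  · calc G * Aᵀ * A * (G * Aᵀ) = (G * (Aᵀ * A) * G) * Aᵀ := by simp only [Matrix.mul_assoc]
      _ = G * Aᵀ := by rw [hGHG]
  · simp [transpose_mul, hGt, Matrix.mul_assoc]
  · simpa [Matrix.mul_assoc] using hsym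

/-- The Moore–Penrose pseudoinverse `A†`. -/
def pinv {n : ℕ} (A : Matrix (Fin n) (Fin n) ℝ) : Matrix (Fin n) (Fin n) ℝ :=
  (exists_isMoorePenrose A).choose

theorem pinv_spec {n : ℕ} (A : Matrix (Fin n) (Fin n) ℝ) : IsMoorePenrose A (pinv A) :=
  (exists_isMoorePenrose A).choose_spec

/-! ### The comparative index -/

/-- The index of a symmetric matrix: the number of its negative eigenvalues, counted with
multiplicity. -/
def ind {n : ℕ} (P : Matrix (Fin n) (Fin n) ℝ) : ℕ :=
  (P.charpoly.roots.filter (fun x => x < 0)).card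

/-- `ℳ = (I - X†X) W(Y, Ŷ)`. -/
def compM {n : ℕ} (Y Y' : Matrix (Fin n ⊕ Fin n) (Fin n) ℝ) : Matrix (Fin n) (Fin n) ℝ :=
  (1 - pinv (upper Y) * upper Y) * wronskian Y Y'

/-- `V = I - ℳ†ℳ`. -/
def compV {n : ℕ} (Y Y' : Matrix (Fin n ⊕ Fin n) (Fin n) ℝ) : Matrix (Fin n) (Fin n) ℝ :=
  1 - pinv (compM Y Y') * compM Y Y'

/-- `𝒫 = V W(Y, Ŷ)ᵀ X† X̂ V`. -/
def compP {n : ℕ} (Y Y' : Matrix (Fin n ⊕ Fin n) (Fin n) ℝ) : Matrix (Fin n) (Fin n) ℝ :=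
  compV Y Y' * (wronskian Y Y')ᵀ * pinv (upper Y) * upper Y' * compV Y Y'

/-- The comparative index `μ(Y, Ŷ) = rank ℳ + ind 𝒫`. -/
def comparativeIndex {n : ℕ} (Y Y' : Matrix (Fin n ⊕ Fin n) (Fin n) ℝ) : ℕ :=
  (compM Y Y').rank + ind (compP Y Y')

/-! ### The oscillation number -/

/-- `a = t₀ < t₁ < ⋯ < t_p = b`. -/
structure IsPartition (a b : ℝ) {p : ℕ} (t : Fin (p + 1) → ℝ) : Prop where
  strictMono : StrictMono t
  first : t 0 = a
  last : t (Fin.last p) = b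

/-- The pairs `(D, R)` that may be used to calculate the oscillation number of `Y` on `[a, b]`:
`D` is a partition `t` of `[a, b]`, and the symplectic matrix functions `R₀, …, R_{p-1}` are such
that on `[t_k, t_{k+1}]` the function `R_k` is continuous, and the ranks of `W(R_k E, Y)` (which is
minus the upper block of `R_k⁻¹ Y`) and of the upper block of `R_k E` are constant. -/
structure IsOscSystem {n : ℕ} (a b : ℝ) (Y : ℝ → Matrix (Fin n ⊕ Fin n) (Fin n) ℝ) {p : ℕ}
    (t : Fin (p + 1) → ℝ) (R : Fin p → ℝ → Matrix (Fin n ⊕ Fin n) (Fin n ⊕ Fin n) ℝ) :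
    Prop where
  isPartition : IsPartition a b t
  symplectic : ∀ k, ∀ s ∈ Set.Icc a b, R k s ∈ Matrix.symplecticGroup (Fin n) ℝ
  continuousOn : ∀ k, ContinuousOn (R k) (Set.Icc (t k.castSucc) (t k.succ))
  rank_wronskian : ∀ k, ∃ r : ℕ, ∀ s ∈ Set.Icc (t k.castSucc) (t k.succ),
    (wronskian (R k s * vertical n) (Y s)).rank = r
  rank_upper : ∀ k, ∃ r : ℕ, ∀ s ∈ Set.Icc (t k.castSucc) (t k.succ),
    (upper (R k s * vertical n)).rank = r

/-- `𝒩(Y, D, R) = ∑_k (μ(Y(t_{k+1}), R_k(t_{k+1}) E) - μ(Y(t_k), R_k(t_k) E))`. -/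
def oscSum {n : ℕ} (Y : ℝ → Matrix (Fin n ⊕ Fin n) (Fin n) ℝ) {p : ℕ}
    (t : Fin (p + 1) → ℝ) (R : Fin p → ℝ → Matrix (Fin n ⊕ Fin n) (Fin n ⊕ Fin n) ℝ) : ℤ :=
  ∑ k : Fin p,
    ((comparativeIndex (Y (t k.succ)) (R k (t k.succ) * vertical n) : ℤ)
      - (comparativeIndex (Y (t k.castSucc)) (R k (t k.castSucc) * vertical n) : ℤ))

/-- `N` is the common value of `𝒩(Y, D, R)` for all admissible `(D, R)`, and there are such. -/
def IsOscillationNumber {n : ℕ} (a b : ℝ) (Y : ℝ → Matrix (Fin n ⊕ Fin n) (Fin n) ℝ)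
    (N : ℤ) : Prop :=
  (∃ (p : ℕ) (t : Fin (p + 1) → ℝ)
    (R : Fin p → ℝ → Matrix (Fin n ⊕ Fin n) (Fin n ⊕ Fin n) ℝ), IsOscSystem a b Y t R) ∧
  ∀ (p : ℕ) (t : Fin (p + 1) → ℝ)
    (R : Fin p → ℝ → Matrix (Fin n ⊕ Fin n) (Fin n ⊕ Fin n) ℝ),
    IsOscSystem a b Y t R → oscSum Y t R = N

open Classical in
/-- The oscillation number `𝒩(Y; [a, b])` (with the value `0` if it is not well defined). -/
def oscillationNumber {n : ℕ} (a b : ℝ) (Y : ℝ → Matrix (Fin n ⊕ Fin n) (Fin n) ℝ) : ℤ :=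
  if h : ∃ N, IsOscillationNumber a b Y N then h.choose else 0

/-! ### The Maslov index -/

/-- `X + i U`. -/
def plusI {n : ℕ} (Y : Matrix (Fin n ⊕ Fin n) (Fin n) ℝ) : Matrix (Fin n) (Fin n) ℂ :=
  (upper Y).map Complex.ofReal + Complex.I • (lower Y).map Complex.ofReal

/-- `X - i U`. -/
def minusI {n : ℕ} (Y : Matrix (Fin n ⊕ Fin n) (Fin n) ℝ) : Matrix (Fin n) (Fin n) ℂ :=
  (upper Y).map Complex.ofReal - Complex.I • (lower Y).map Complex.ofReal

/-- `Γ = -(X + i U) (X - i U)⁻¹ (X̂ - i Û) (X̂ + i Û)⁻¹`. -/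
def Gam {n : ℕ} (Y Y' : Matrix (Fin n ⊕ Fin n) (Fin n) ℝ) : Matrix (Fin n) (Fin n) ℂ :=
  -(plusI Y * (minusI Y)⁻¹ * minusI Y' * (plusI Y')⁻¹)

/-- The matrix `Γ - exp (i (π + θ)) I`. -/
def GamShift {n : ℕ} (Y Y' : Matrix (Fin n ⊕ Fin n) (Fin n) ℝ) (θ : ℝ) :
    Matrix (Fin n) (Fin n) ℂ :=
  Gam Y Y' - Complex.exp (Complex.I * ((Real.pi + θ : ℝ) : ℂ)) • (1 : Matrix (Fin n) (Fin n) ℂ)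

/-- The defect of a square matrix, i.e. the dimension of its kernel. -/
def defect {n : ℕ} (A : Matrix (Fin n) (Fin n) ℂ) : ℕ :=
  Module.finrank ℂ (LinearMap.ker A.mulVecLin)

/-- `ℓ(ε) = ∑_{θ ∈ [0, ε)} def (Γ - exp (i (π + θ)) I)`, where for `ε ≤ π` only finitely many
summands do not vanish. -/
def ell {n : ℕ} (Y Y' : Matrix (Fin n ⊕ Fin n) (Fin n) ℝ) (ε : ℝ) : ℕ :=
  ∑ᶠ θ ∈ Set.Ico (0 : ℝ) ε, defect (GamShift Y Y' θ)

/-- The partitions `t` of `[a, b]` with numbers `ε_k ∈ (0, π)` that may be used to calculate the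
Maslov index: `exp (i (π ± ε_k))` is not an eigenvalue of `Γ(s)` for `s` in the `k`-th subinterval,
endpoints included. -/
structure IsMaslovSystem {n : ℕ} (a b : ℝ) (Y Y' : ℝ → Matrix (Fin n ⊕ Fin n) (Fin n) ℝ) {p : ℕ}
    (t : Fin (p + 1) → ℝ) (ε : Fin p → ℝ) : Prop where
  isPartition : IsPartition a b t
  mem_Ioo : ∀ k, ε k ∈ Set.Ioo 0 Real.pi
  isUnit_plus : ∀ k, ∀ s ∈ Set.Icc (t k.castSucc) (t k.succ), IsUnit (GamShift (Y s) (Y' s) (ε k))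
  isUnit_minus : ∀ k, ∀ s ∈ Set.Icc (t k.castSucc) (t k.succ),
    IsUnit (GamShift (Y s) (Y' s) (-ε k))

/-- `∑_k (ℓ(t_k, ε_k) - ℓ(t_{k-1}, ε_k))`. -/
def maslovSum {n : ℕ} (Y Y' : ℝ → Matrix (Fin n ⊕ Fin n) (Fin n) ℝ) {p : ℕ}
    (t : Fin (p + 1) → ℝ) (ε : Fin p → ℝ) : ℤ :=
  ∑ k : Fin p, ((ell (Y (t k.succ)) (Y' (t k.succ)) (ε k) : ℤ)
    - (ell (Y (t k.castSucc)) (Y' (t k.castSucc)) (ε k) : ℤ))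

/-- `m` is the common value of the sums `maslovSum` for all admissible partitions and numbers
`ε_k`, and there are such. -/
def IsMaslovIndex {n : ℕ} (a b : ℝ) (Y Y' : ℝ → Matrix (Fin n ⊕ Fin n) (Fin n) ℝ)
    (m : ℤ) : Prop :=
  (∃ (p : ℕ) (t : Fin (p + 1) → ℝ) (ε : Fin p → ℝ), IsMaslovSystem a b Y Y' t ε) ∧
  ∀ (p : ℕ) (t : Fin (p + 1) → ℝ) (ε : Fin p → ℝ),
    IsMaslovSystem a b Y Y' t ε → maslovSum Y Y' t ε = m

open Classical in
/-- The Maslov index `Mas(Y, Ŷ; [a, b])` (with the value `0` if it is not well defined). -/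
def maslovIndex {n : ℕ} (a b : ℝ) (Y Y' : ℝ → Matrix (Fin n ⊕ Fin n) (Fin n) ℝ) : ℤ :=
  if h : ∃ m, IsMaslovIndex a b Y Y' m then h.choose else 0

end

end LagrangianPaths

open Matrix

namespace LagrangianPaths

noncomputable section

/-! Locally every Lagrangian plane is the graph of a symmetric matrix, and both indices become
counts of negative eigenvalues. If `U + cX` is invertible, the plane of `Y` is encoded by the
symmetric matrix `A = X (U + cX)⁻¹`. Let `B` be the matrix so attached to a second plane `Z`, and
write `ind` for the number of negative eigenvalues. A generalized Schur complement argument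
(`negIndex_fromBlocks`, `comparativeIndex_add_negIndex`) gives μ(Y, Z) = ind (A - B) + ind B - ind
A. For `c > 0`, the eigenvalues of `Γ` at the angles `π + θ`, `0 ≤ θ < π`, correspond monotonically
to eigenvalues `sin (θ/2) / (cos (θ/2) + c sin (θ/2))` of `A`, so with `λ` the value at `θ = ε`
(`ell_add_negIndex`) ℓ(Y, ε) = ind (A - λI) - ind A.

The term `ind A`, which is what jumps when `Y` meets the vertical plane, cancels in the difference:
μ - ℓ = ind (A - B) + ind B - ind (A - λI). Along the paths the ranks of `A - B` and `B` are those
of `W(Z, Y)` and of the upper block of `Z`, constant by admissibility, while `A - λI` is invertible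
because `e^{i(π+ε)}` is not an eigenvalue of `Γ`. The index of a continuous symmetric family of
constant rank is locally constant (`eventually_negIndex_eq`), hence so is `μ - ℓ`.

Each of the two sums is the increment of a function on `[a, b]`, and the difference of these
functions is locally constant, hence constant. Thus every admissible oscillation sum equals every
admissible Maslov sum (`oscSum_eq_maslovSum`). Since admissible choices exist on both sides, this
one identity gives independence of the choices for both invariants as well as their equality. -/

/-! ### The index of a symmetric matrix -/

/-- The number of negative roots of the characteristic polynomial. -/
def negIndex {ι : Type*} [Fintype ι] [DecidableEq ι] (Q : Matrix ι ι ℝ) : ℕ :=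
  (Q.charpoly.roots.filter (fun x => x < 0)).card

/-- General index types are needed because the argument passes through symmetric matrices indexed by
`Fin n ⊕ Fin n`. -/
theorem ind_eq_negIndex {n : ℕ} (P : Matrix (Fin n) (Fin n) ℝ) : ind P = negIndex P := rfl

theorem isHermitian_iff_transpose {ι : Type*} {Q : Matrix ι ι ℝ} : Q.IsHermitian ↔ Qᵀ = Q := by
  rw [Matrix.IsHermitian, conjTranspose_eq_transpose_of_trivial]

theorem isHermitian_transpose_mul_mul {ι κ : Type*} [Fintype ι] {Q : Matrix ι ι ℝ}
    (hQ : Q.IsHermitian) (T : Matrix ι κ ℝ) : (Tᵀ * Q * T).IsHermitian := by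
  rw [isHermitian_iff_transpose] at hQ ⊢
  rw [transpose_mul, transpose_mul, transpose_transpose, hQ, Matrix.mul_assoc]

section NegIndex

variable {ι κ : Type*} [Fintype ι] [DecidableEq ι] [Fintype κ] [DecidableEq κ]

theorem card_filter_roots_charpoly {Q : Matrix ι ι ℝ} (hQ : Q.IsHermitian) (p : ℝ → Prop)
    [DecidablePred p] :
    (Q.charpoly.roots.filter p).card = {i | p (hQ.eigenvalues i)}.ncard := by
  rw [hQ.roots_charpoly_eq_eigenvalues, Multiset.filter_map, Multiset.card_map,
    Set.ncard_eq_toFinset_card', Finset.card]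
  congr 1
  ext i
  simp [Multiset.count_filter, Multiset.count_univ]

theorem toQuadraticForm'_apply (Q : Matrix ι ι ℝ) (x : ι → ℝ) :
    Q.toQuadraticForm' x = x ⬝ᵥ Q *ᵥ x := by
  simp [Matrix.toQuadraticForm', toLinearMap₂'_apply']

theorem equivalent_transpose_mul_mul (Q T : Matrix ι ι ℝ) (hT : IsUnit T) :
    QuadraticMap.Equivalent (Tᵀ * Q * T).toQuadraticForm' Q.toQuadraticForm' := by
  have hdet := (Matrix.isUnit_iff_isUnit_det T).mp hT
  refine ⟨⟨LinearEquiv.ofLinearMap T.mulVecLin T⁻¹.mulVecLin ?_ ?_, ?_⟩⟩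
  · rw [← Matrix.mulVecLin_mul, Matrix.mul_nonsing_inv _ hdet, Matrix.mulVecLin_one]
  · rw [← Matrix.mulVecLin_mul, Matrix.nonsing_inv_mul _ hdet, Matrix.mulVecLin_one]
  · intro x
    simp [toQuadraticForm'_apply, ← Matrix.mulVec_mulVec, Matrix.dotProduct_mulVec,
      Matrix.vecMul_transpose]

theorem toQuadraticForm'_diagonal (d : ι → ℝ) :
    (diagonal d).toQuadraticForm' = QuadraticMap.weightedSumSquares ℝ d := by
  ext x
  simp only [toQuadraticForm'_apply, QuadraticMap.weightedSumSquares_apply, dotProduct,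
    mulVec_diagonal, smul_eq_mul]
  exact Finset.sum_congr rfl fun i _ => by ring

/-- Diagonalization by an orthogonal matrix is at once a similarity and a congruence, so the
spectral count agrees with an invariant of the quadratic form. -/
theorem negIndex_eq_sigNeg {Q : Matrix ι ι ℝ} (hQ : Q.IsHermitian) :
    negIndex Q = sigNeg Q.toQuadraticForm' := by
  have h1 := equivalent_transpose_mul_mul Q (hQ.eigenvectorUnitary : Matrix ι ι ℝ)
    (Unitary.toUnits hQ.eigenvectorUnitary).isUnit
  have h2 : (hQ.eigenvectorUnitary : Matrix ι ι ℝ)ᵀ * Q * (hQ.eigenvectorUnitary : Matrix ι ι ℝ)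
      = diagonal hQ.eigenvalues := by
    have := hQ.conjStarAlgAut_star_eigenvectorUnitary
    simpa [Unitary.conjStarAlgAut_star_apply, Function.comp_def, star_eq_conjTranspose] using this
  rw [h2, toQuadraticForm'_diagonal] at h1
  rw [QuadraticForm.sigNeg_of_equiv_weightedSumSquares h1.symm, negIndex,
    card_filter_roots_charpoly hQ]

/-- Sylvester's law of inertia. -/
theorem negIndex_transpose_mul_mul {Q : Matrix ι ι ℝ} (hQ : Q.IsHermitian) {T : Matrix ι ι ℝ}
    (hT : IsUnit T) : negIndex (Tᵀ * Q * T) = negIndex Q := by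
  rw [negIndex_eq_sigNeg hQ, negIndex_eq_sigNeg (isHermitian_transpose_mul_mul hQ T)]
  exact (equivalent_transpose_mul_mul Q T hT).sigNeg_eq

theorem negIndex_sub_smul_one {Q : Matrix ι ι ℝ} (hQ : Q.IsHermitian) (c : ℝ) :
    negIndex (Q - c • 1) = {i | hQ.eigenvalues i < c}.ncard := by
  rw [← card_filter_roots_charpoly hQ (· < c), negIndex]
  have h : (Q - c • (1 : Matrix ι ι ℝ)) = Q - scalar ι c := by
    simp [smul_one_eq_diagonal]
  rw [h, Matrix.charpoly_sub_scalar, hQ.charpoly_eq, Polynomial.prod_comp]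
  have h2 : (∏ i, (Polynomial.X - Polynomial.C (hQ.eigenvalues i : ℝ)).comp
      (Polynomial.X + Polynomial.C c)) = ∏ i, (Polynomial.X - Polynomial.C (hQ.eigenvalues i - c)) := by
    refine Finset.prod_congr rfl fun i _ => ?_
    simp
    ring
  have h3 : ∀ f : ι → ℝ, (∏ i, (Polynomial.X - Polynomial.C (f i))).roots
      = Multiset.map f Finset.univ.val := by
    intro f
    rw [Polynomial.roots_prod _ _ (by simp [Finset.prod_ne_zero_iff, Polynomial.X_sub_C_ne_zero])]
    simp
  erw [h2, h3, h3]
  rw [Multiset.filter_map, Multiset.filter_map, Multiset.card_map, Multiset.card_map]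
  simp [sub_neg]

theorem negIndex_eq_ncard {Q : Matrix ι ι ℝ} (hQ : Q.IsHermitian) :
    negIndex Q = {i | hQ.eigenvalues i < 0}.ncard :=
  card_filter_roots_charpoly hQ _

/-- If `PQ = 0`, then `(x - P)(x - Q) = x (x - (P + Q))`; take determinants. -/
theorem charpoly_mul_charpoly_of_mul_eq_zero {P Q : Matrix ι ι ℝ} (h : P * Q = 0) :
    P.charpoly * Q.charpoly = Polynomial.X ^ Fintype.card ι * (P + Q).charpoly := by
  have hPQ : (P.map Polynomial.C) * (Q.map Polynomial.C) = 0 := by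
    rw [← Matrix.map_mul, h, Matrix.map_zero _ (map_zero _)]
  have hX : (Polynomial.X ^ Fintype.card ι : Polynomial ℝ)
      = (scalar ι (Polynomial.X : Polynomial ℝ)).det := by
    rw [scalar_apply, det_diagonal, Finset.prod_const, Finset.card_univ]
  have hc : P.map Polynomial.C * scalar ι (Polynomial.X : Polynomial ℝ)
      = scalar ι (Polynomial.X : Polynomial ℝ) * P.map Polynomial.C :=
    ((scalar_commute _ (fun r => Commute.all _ r) _).eq).symm
  have hadd : (P + Q).map (Polynomial.C : ℝ → Polynomial ℝ)
      = P.map Polynomial.C + Q.map Polynomial.C := Matrix.map_add _ (map_add _) P Q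
  rw [hX, charpoly, charpoly, charpoly, ← det_mul, ← det_mul]
  congr 1
  unfold charmatrix
  simp only [RingHom.mapMatrix_apply]
  rw [hadd, mul_sub, sub_mul, sub_mul, hPQ, mul_sub, mul_add, hc]
  abel

theorem negIndex_add_of_mul_eq_zero {P Q : Matrix ι ι ℝ} (h : P * Q = 0) :
    negIndex (P + Q) = negIndex P + negIndex Q := by
  have hmul := charpoly_mul_charpoly_of_mul_eq_zero h
  have hr := congrArg Polynomial.roots hmul
  rw [Polynomial.roots_mul (mul_ne_zero P.charpoly_monic.ne_zero Q.charpoly_monic.ne_zero),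
    Polynomial.roots_mul (mul_ne_zero (pow_ne_zero _ Polynomial.X_ne_zero)
      (P + Q).charpoly_monic.ne_zero), Polynomial.roots_pow, Polynomial.roots_X] at hr
  have := congrArg (fun s => (s.filter (fun x : ℝ => x < 0)).card) hr
  simp only [Multiset.filter_add, Multiset.card_add, Multiset.filter_nsmul] at this
  simpa [negIndex, Multiset.filter_singleton] using this.symm

theorem negIndex_fromBlocks_diagonal (A : Matrix ι ι ℝ) (B : Matrix κ κ ℝ) :
    negIndex (fromBlocks A 0 0 B) = negIndex A + negIndex B := by
  rw [negIndex, charpoly_fromBlocks_zero₂₁, Polynomial.roots_mul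
    (mul_ne_zero A.charpoly_monic.ne_zero B.charpoly_monic.ne_zero), Multiset.filter_add,
    Multiset.card_add]
  rfl

/-- The rank counts the nonzero eigenvalues, negative and positive. Under constant rank, this turns
a lower bound for the index of `-Q` into an upper bound for that of `Q`. -/
theorem negIndex_add_negIndex_neg {Q : Matrix ι ι ℝ} (hQ : Q.IsHermitian) :
    negIndex Q + negIndex (-Q) = Q.rank := by
  have h1 : negIndex (-Q) = {i | 0 < hQ.eigenvalues i}.ncard := by
    have h2 := equivalent_transpose_mul_mul (-Q) (hQ.eigenvectorUnitary : Matrix ι ι ℝ)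
      (Unitary.toUnits hQ.eigenvectorUnitary).isUnit
    have h3 : (hQ.eigenvectorUnitary : Matrix ι ι ℝ)ᵀ * (-Q)
        * (hQ.eigenvectorUnitary : Matrix ι ι ℝ) = diagonal (fun i => -hQ.eigenvalues i) := by
      have := congrArg Neg.neg hQ.conjStarAlgAut_star_eigenvectorUnitary
      simpa [Unitary.conjStarAlgAut_star_apply, Function.comp_def, star_eq_conjTranspose]
        using this
    rw [h3, toQuadraticForm'_diagonal] at h2
    rw [negIndex_eq_sigNeg hQ.neg, QuadraticForm.sigNeg_of_equiv_weightedSumSquares h2.symm]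
    simp
  rw [h1, negIndex_eq_ncard hQ, hQ.rank_eq_card_non_zero_eigs, ← Set.ncard_union_eq]
  · rw [← Nat.card_eq_fintype_card, ← Nat.card_coe_set_eq]
    congr 1
    congr 1
    ext i
    simp only [Set.mem_union, Set.mem_ofPred_eq, lt_or_lt_iff_ne]
    exact Iff.rfl
  · rw [Set.disjoint_left]
    intro i hi hi'
    simp only [Set.mem_ofPred_eq] at hi hi'
    linarith

open Filter Topology in
-- Lower semicontinuity: a maximal negative definite subspace of the limit form stays negative
-- definite for nearby forms, by compactness of its unit sphere.
theorem eventually_negIndex_le {α : Type*} {l : Filter α} {Q : α → Matrix ι ι ℝ}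
    {Q₀ : Matrix ι ι ℝ} (hlim : Tendsto Q l (𝓝 Q₀)) (hQ₀ : Q₀.IsHermitian)
    (hQ : ∀ᶠ s in l, (Q s).IsHermitian) : ∀ᶠ s in l, negIndex Q₀ ≤ negIndex (Q s) := by
  obtain ⟨V, hV, hneg⟩ := exists_finrank_eq_sigNeg_and_negDef Q₀.toQuadraticForm'
  let K : Set (ι → ℝ) := Metric.sphere 0 1 ∩ V
  have hK : IsCompact K := (isCompact_sphere _ _).inter_right V.closed_of_finiteDimensional
  have hcont : Continuous fun q : Matrix ι ι ℝ × (ι → ℝ) => q.2 ⬝ᵥ q.1 *ᵥ q.2 := by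
    fun_prop
  have hev : ∀ᶠ q in 𝓝 Q₀, ∀ x ∈ K, x ⬝ᵥ q *ᵥ x < 0 := by
    refine hK.eventually_forall_of_forall_eventually fun x hx => ?_
    refine hcont.continuousAt.eventually_lt_const ?_
    have hx0 : x ≠ 0 := by
      rintro rfl
      simpa [K] using hx.1
    have := hneg ⟨x, hx.2⟩ (by simpa using hx0)
    simpa [toQuadraticForm'_apply] using this
  filter_upwards [hlim.eventually hev, hQ] with s hs hsym
  rw [negIndex_eq_sigNeg hQ₀, ← hV, negIndex_eq_sigNeg hsym]
  refine le_sigNeg_of_negDef _ ?_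
  rintro ⟨x, hx⟩ hx0
  have hx0 : x ≠ 0 := by simpa using hx0
  have hn : 0 < ‖x‖ := norm_pos_iff.mpr hx0
  -- Negativity is known on the unit sphere only; homogeneity extends it to all nonzero vectors.
  have := hs (‖x‖⁻¹ • x) ⟨by simp [norm_smul, hn.ne'], V.smul_mem _ hx⟩
  rw [mulVec_smul, dotProduct_smul, smul_dotProduct, smul_smul, smul_eq_mul] at this
  have h2 : x ⬝ᵥ Q s *ᵥ x < 0 := by
    by_contra hcon
    push Not at hcon
    have : 0 ≤ ‖x‖⁻¹ * ‖x‖⁻¹ * (x ⬝ᵥ Q s *ᵥ x) := by positivity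
    linarith
  simpa [toQuadraticForm'_apply] using h2

open Filter Topology in
/-- The index of a continuous family of symmetric matrices of constant rank is locally constant. -/
theorem eventually_negIndex_eq {α : Type*} {l : Filter α} {Q : α → Matrix ι ι ℝ}
    {Q₀ : Matrix ι ι ℝ} (hlim : Tendsto Q l (𝓝 Q₀)) (hQ₀ : Q₀.IsHermitian)
    (hQ : ∀ᶠ s in l, (Q s).IsHermitian) (hrank : ∀ᶠ s in l, (Q s).rank = Q₀.rank) :
    ∀ᶠ s in l, negIndex (Q s) = negIndex Q₀ := by
  filter_upwards [eventually_negIndex_le hlim hQ₀ hQ,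
    eventually_negIndex_le hlim.neg hQ₀.neg (hQ.mono fun s hs => hs.neg), hQ, hrank]
    with s h1 h2 h3 h4
  -- Neither the negative nor the positive index can drop in the limit's neighbourhood, and their
  -- sum is the constant rank, so neither can grow.
  have h5 := negIndex_add_negIndex_neg hQ₀
  have h6 := negIndex_add_negIndex_neg h3
  omega

end NegIndex

/-! ### Block matrices and shear congruences -/

section Schur

variable {ι : Type*} [Fintype ι] [DecidableEq ι]

theorem rank_fromBlocks_diagonal {A B : Matrix ι ι ℝ} (hA : A.IsHermitian) (hB : B.IsHermitian) :
    (fromBlocks A 0 0 B).rank = A.rank + B.rank := by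
  have h : (fromBlocks A 0 0 B).IsHermitian := hA.fromBlocks (by simp) hB
  rw [← negIndex_add_negIndex_neg h, ← negIndex_add_negIndex_neg hA,
    ← negIndex_add_negIndex_neg hB, fromBlocks_neg, neg_zero, negIndex_fromBlocks_diagonal,
    negIndex_fromBlocks_diagonal]
  ring

/-- Conjugation by `diag(1, -1)` changes the sign of the matrix, so its positive and negative
indices agree, and each is half of the rank `2 rank M`. -/
theorem negIndex_fromBlocks_offDiagonal (M : Matrix ι ι ℝ) :
    negIndex (fromBlocks 0 M Mᵀ 0) = M.rank := by
  set N : Matrix (ι ⊕ ι) (ι ⊕ ι) ℝ := fromBlocks 0 M Mᵀ 0 with hN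
  have hNt : Nᵀ = N := by simp [hN, fromBlocks_transpose]
  have hsym : N.IsHermitian := isHermitian_iff_transpose.mpr hNt
  have hrank : N.rank = M.rank + M.rank := by
    have h1 : Nᵀ * N = fromBlocks (M * Mᵀ) 0 0 (Mᵀ * M) := by
      rw [hNt, hN, fromBlocks_multiply]; simp
    rw [← rank_transpose_mul_self, h1, rank_fromBlocks_diagonal, rank_self_mul_transpose,
      rank_transpose_mul_self]
    · rw [isHermitian_iff_transpose]; simp
    · rw [isHermitian_iff_transpose]; simp
  have hneg : negIndex (-N) = negIndex N := by
    set T : Matrix (ι ⊕ ι) (ι ⊕ ι) ℝ := fromBlocks 1 0 0 (-1) with hT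
    have h1 : Tᵀ * N * T = -N := by
      simp [hT, hN, fromBlocks_transpose, fromBlocks_multiply, fromBlocks_neg]
    have h2 : T * T = 1 := by simp [hT, fromBlocks_multiply]
    rw [← h1, negIndex_transpose_mul_mul hsym (IsUnit.of_mul_eq_one T h2)]
  have := negIndex_add_negIndex_neg hsym
  omega

theorem isUnit_fromBlocks_one_zero_one (L : Matrix ι ι ℝ) :
    IsUnit (fromBlocks 1 L 0 1 : Matrix (ι ⊕ ι) (ι ⊕ ι) ℝ) := by
  rw [Matrix.isUnit_iff_isUnit_det, det_fromBlocks_zero₂₁]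
  simp

theorem transpose_shear_mul_fromBlocks_mul_shear (S N D L : Matrix ι ι ℝ) :
    (fromBlocks 1 L 0 1 : Matrix (ι ⊕ ι) (ι ⊕ ι) ℝ)ᵀ * fromBlocks S N Nᵀ D * fromBlocks 1 L 0 1
      = fromBlocks S (S * L + N) (Lᵀ * S + Nᵀ) (Lᵀ * S * L + Lᵀ * N + Nᵀ * L + D) := by
  simp [fromBlocks_transpose, fromBlocks_multiply, Matrix.add_mul]
  abel

end Schur

/-! ### Generalized Schur complements with the pseudoinverse -/

theorem pinv_transpose {n : ℕ} {S : Matrix (Fin n) (Fin n) ℝ} (hS : Sᵀ = S) :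
    (pinv S)ᵀ = pinv S := by
  have h := pinv_spec S
  refine IsMoorePenrose.unique (A := S) ⟨?_, ?_, ?_, ?_⟩ h
  · have := congrArg transpose h.mul_mul_self
    simpa [transpose_mul, hS, Matrix.mul_assoc] using this
  · have := congrArg transpose h.mul_mul_inv
    simpa [transpose_mul, hS, Matrix.mul_assoc] using this
  · have := congrArg transpose h.symm_right
    simpa [transpose_mul, hS] using this
  · have := congrArg transpose h.symm_left
    simpa [transpose_mul, hS] using this

theorem pinv_mul_comm {n : ℕ} {S : Matrix (Fin n) (Fin n) ℝ} (hS : Sᵀ = S) :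
    pinv S * S = S * pinv S := by
  have := (pinv_spec S).symm_left
  rwa [transpose_mul, hS, pinv_transpose hS] at this

/-- The index of a symmetric block matrix, in terms of a generalized Schur complement. -/
theorem negIndex_fromBlocks {n : ℕ} {S N D M V : Matrix (Fin n) (Fin n) ℝ} (hS : Sᵀ = S)
    (hD : Dᵀ = D) (hM : M = (1 - pinv S * S) * N) (hV : V = 1 - pinv M * M) :
    negIndex (fromBlocks S N Nᵀ D)
      = negIndex S + M.rank + negIndex (V * (D - Nᵀ * pinv S * N) * V) := by
  set G := pinv S with hG
  set H := pinv M with hH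
  have hGt : Gᵀ = G := pinv_transpose hS
  have hGS : G * S = S * G := pinv_mul_comm hS
  have hSGS : S * G * S = S := (pinv_spec S).mul_mul_self
  have hMHM : M * H * M = M := (pinv_spec M).mul_mul_self
  have hHMH : H * M * H = H := (pinv_spec M).mul_mul_inv
  have hHM : (H * M)ᵀ = H * M := (pinv_spec M).symm_right
  have hHM' : Mᵀ * Hᵀ = H * M := by rw [← transpose_mul, hHM]
  set D' := D - Nᵀ * G * N with hD'
  have hDt : D'ᵀ = D' := by
    simp [hD', transpose_mul, hGt, hD, Matrix.mul_assoc]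
  have hSM : S * M = 0 := by
    rw [hM, ← Matrix.mul_assoc, Matrix.mul_sub, ← Matrix.mul_assoc, hSGS]; simp
  have hSH : S * Hᵀ = 0 := by
    have h1 : Hᵀ = M * (H * Hᵀ) := by
      rw [← Matrix.mul_assoc, ← (pinv_spec M).symm_left, ← transpose_mul, ← Matrix.mul_assoc, hHMH]
    rw [h1, ← Matrix.mul_assoc, hSM, Matrix.zero_mul]
  have hMV : M * V = 0 := by
    rw [hV, Matrix.mul_sub, ← Matrix.mul_assoc, hMHM]; simp
  have hVt : Vᵀ = V := by
    rw [hV, transpose_sub, hHM, transpose_one]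
  have hQ : (fromBlocks S N Nᵀ D).IsHermitian := by
    rw [isHermitian_iff_transpose, fromBlocks_transpose, hS, hD, transpose_transpose]
  -- The shear by `-(S†N)` removes the part of `N` in the range of `S`; what is left of the
  -- off-diagonal block is `M`.
  have step1 : negIndex (fromBlocks S N Nᵀ D) = negIndex (fromBlocks S M Mᵀ D') := by
    rw [← negIndex_transpose_mul_mul hQ (isUnit_fromBlocks_one_zero_one (-(G * N))),
      transpose_shear_mul_fromBlocks_mul_shear]
    have e1 : S * -(G * N) + N = M := by
      rw [hM, hGS]; noncomm_ring
    have e2 : (-(G * N))ᵀ * S + Nᵀ = Mᵀ := by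
      rw [← e1]; simp [transpose_mul, hS, hGt, Matrix.mul_assoc]
    have e3 : (-(G * N))ᵀ * S * -(G * N) + (-(G * N))ᵀ * N + Nᵀ * -(G * N) + D = D' := by
      have : (-(G * N))ᵀ = -(Nᵀ * G) := by simp [transpose_mul, hGt]
      rw [this, hD']
      have e4 : -(Nᵀ * G) * S * -(G * N) = Nᵀ * G * N := by
        calc -(Nᵀ * G) * S * -(G * N) = Nᵀ * (G * S * G) * N := by noncomm_ring
          _ = _ := by rw [hG, (pinv_spec S).mul_mul_inv]
      rw [e4]
      noncomm_ring
    rw [e1, e2, e3]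
  -- Since `S * K = 0`, the shear by `-K` leaves the blocks `S` and `M` alone and only changes `D'`.
  -- With the projection `C = H * M = 1 - V`, it removes `C D' V`, `V D' C` and `C D' C`; the factor
  -- `1/2` is there because `C D' C` is hit twice, through `Mᵀ K` and through `Kᵀ M`.
  set K := Hᵀ * D' * V + (1 / 2 : ℝ) • (Hᵀ * D' * (H * M)) with hK
  have hSK : S * K = 0 := by
    simp [hK, Matrix.mul_add, ← Matrix.mul_assoc, hSH]
  have hKt : Kᵀ = V * D' * H + (1 / 2 : ℝ) • (H * M * D' * H) := by
    rw [hK]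
    simp only [transpose_add, transpose_smul, transpose_mul, transpose_transpose, hDt, hVt, hHM']
    simp [Matrix.mul_assoc]
  have hKS : Kᵀ * S = 0 := by
    rw [← hS, ← transpose_mul, hSK, transpose_zero]
  have hQ2 : (fromBlocks S M Mᵀ D').IsHermitian := by
    rw [isHermitian_iff_transpose, fromBlocks_transpose, hS, hDt, transpose_transpose]
  have step2 : negIndex (fromBlocks S M Mᵀ D') = negIndex (fromBlocks S M Mᵀ (V * D' * V)) := by
    rw [← negIndex_transpose_mul_mul hQ2 (isUnit_fromBlocks_one_zero_one (-K)),
      transpose_shear_mul_fromBlocks_mul_shear]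
    have e3 : (-K)ᵀ * S * -K + (-K)ᵀ * M + Mᵀ * -K + D' = V * D' * V := by
      have h1 : Mᵀ * K = H * M * D' * V + (1 / 2 : ℝ) • (H * M * D' * (H * M)) := by
        rw [hK, Matrix.mul_add, Matrix.mul_smul]
        simp only [← Matrix.mul_assoc]
        rw [hHM']
      have h2 : Kᵀ * M = V * D' * (H * M) + (1 / 2 : ℝ) • (H * M * D' * (H * M)) := by
        rw [hKt, Matrix.add_mul, Matrix.smul_mul]
        simp only [Matrix.mul_assoc]
      have h3 : D' = (V + H * M) * D' * (V + H * M) := by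
        rw [hV]; simp
      have h4 : (-K)ᵀ * S * -K = 0 := by rw [transpose_neg, Matrix.neg_mul, hKS]; simp
      rw [h4, transpose_neg, Matrix.neg_mul, Matrix.mul_neg, h1, h2]
      set C := H * M
      have h9 : (1 / 2 : ℝ) • (C * D' * C) + (1 / 2 : ℝ) • (C * D' * C) = C * D' * C := by
        rw [← add_smul]; norm_num
      have h10 : (V + C) * D' * (V + C)
          = V * D' * V + V * D' * C + C * D' * V + C * D' * C := by noncomm_ring
      rw [h10, ← h9] at h3
      generalize V * D' * V = p at h3 ⊢
      generalize V * D' * C = q at h3 ⊢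
      generalize C * D' * V = r at h3 ⊢
      generalize (1 / 2 : ℝ) • (C * D' * C) = w at h3 ⊢
      rw [h3]
      abel
    rw [e3]
    simp [hSK, hKS]
  -- The two summands multiply to zero, because `S * M = 0` and `V * Mᵀ = 0`, so their indices add.
  have hQ3 : fromBlocks S M Mᵀ (V * D' * V)
      = fromBlocks S 0 0 (V * D' * V) + fromBlocks 0 M Mᵀ 0 := by
    rw [fromBlocks_add]; simp
  have hVM : V * Mᵀ = 0 := by
    have := congrArg transpose hMV
    simpa [transpose_mul, hVt] using this
  have hmul : fromBlocks S 0 0 (V * D' * V) * fromBlocks 0 M Mᵀ 0 = 0 := by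
    rw [fromBlocks_multiply]
    simp [hSM, Matrix.mul_assoc, hVM]
  rw [step1, step2, hQ3, negIndex_add_of_mul_eq_zero hmul, negIndex_fromBlocks_diagonal,
    negIndex_fromBlocks_offDiagonal]
  ring

/-! ### Lagrangian planes as graphs of symmetric matrices, and the comparative index -/

variable {n : ℕ}

theorem wronskian_eq (Y Z : Matrix (Fin n ⊕ Fin n) (Fin n) ℝ) :
    wronskian Y Z = (upper Y)ᵀ * lower Z - (lower Y)ᵀ * upper Z := by
  have hY : Y = fromRows (upper Y) (lower Y) := (fromRows_toRows Y).symm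
  have hZ : Z = fromRows (upper Z) (lower Z) := (fromRows_toRows Z).symm
  conv_lhs => rw [hY, hZ]
  rw [wronskian, canonicalJ, Matrix.mul_assoc, fromBlocks_mul_fromRows, transpose_fromRows,
    fromCols_mul_fromRows]
  simp [sub_eq_add_neg]

theorem IsLagrangian.transpose_upper_mul_lower {Y : Matrix (Fin n ⊕ Fin n) (Fin n) ℝ}
    (hY : IsLagrangian Y) : (upper Y)ᵀ * lower Y = (lower Y)ᵀ * upper Y := by
  have h := hY.1
  change wronskian Y Y = 0 at h
  rw [wronskian_eq] at h
  exact sub_eq_zero.mp h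

/-- The matrix `U + c X`. It is invertible if and only if the plane spanned by `Y` is transversal
to the plane `{U = -c X}`. -/
def shearLower (c : ℝ) (Y : Matrix (Fin n ⊕ Fin n) (Fin n) ℝ) : Matrix (Fin n) (Fin n) ℝ :=
  lower Y + c • upper Y

/-- The symmetric matrix `X (U + c X)⁻¹` representing a Lagrangian plane which is transversal to
the plane `{U = -c X}`. -/
def graphMatrix (c : ℝ) (Y : Matrix (Fin n ⊕ Fin n) (Fin n) ℝ) : Matrix (Fin n) (Fin n) ℝ :=
  upper Y * (shearLower c Y)⁻¹

/-- The shear `(X, U) ↦ (X, U + cX)` is symplectic: the two terms with `c` cancel. -/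
theorem wronskian_eq_shearLower (c : ℝ) (Y Z : Matrix (Fin n ⊕ Fin n) (Fin n) ℝ) :
    wronskian Y Z = (upper Y)ᵀ * shearLower c Z - (shearLower c Y)ᵀ * upper Z := by
  rw [wronskian_eq, shearLower, shearLower]
  simp [Matrix.mul_add, Matrix.add_mul]

theorem graphMatrix_mul {c : ℝ} {Y : Matrix (Fin n ⊕ Fin n) (Fin n) ℝ}
    (hc : IsUnit (shearLower c Y)) : graphMatrix c Y * shearLower c Y = upper Y := by
  rw [graphMatrix, Matrix.mul_assoc,
    Matrix.nonsing_inv_mul _ ((Matrix.isUnit_iff_isUnit_det _).mp hc), Matrix.mul_one]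

theorem IsLagrangian.transpose_upper_mul_shearLower {Y : Matrix (Fin n ⊕ Fin n) (Fin n) ℝ}
    (hY : IsLagrangian Y) (c : ℝ) :
    (upper Y)ᵀ * shearLower c Y = (shearLower c Y)ᵀ * upper Y := by
  rw [shearLower, Matrix.mul_add, hY.transpose_upper_mul_lower]
  simp [Matrix.add_mul]

theorem IsLagrangian.transpose_graphMatrix {Y : Matrix (Fin n ⊕ Fin n) (Fin n) ℝ}
    (hY : IsLagrangian Y) {c : ℝ} (hc : IsUnit (shearLower c Y)) :
    (graphMatrix c Y)ᵀ = graphMatrix c Y := by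
  have hd := (Matrix.isUnit_iff_isUnit_det _).mp hc
  have h := hY.transpose_upper_mul_shearLower c
  have h2 : (graphMatrix c Y)ᵀ = ((shearLower c Y)⁻¹)ᵀ * ((upper Y)ᵀ * shearLower c Y)
      * (shearLower c Y)⁻¹ := by
    rw [graphMatrix, transpose_mul, Matrix.mul_assoc, Matrix.mul_assoc,
      Matrix.mul_nonsing_inv _ hd, Matrix.mul_one]
  rw [h2, h, ← Matrix.mul_assoc, ← transpose_mul, Matrix.mul_nonsing_inv _ hd]
  simp [graphMatrix]

theorem IsLagrangian.isHermitian_graphMatrix {Y : Matrix (Fin n ⊕ Fin n) (Fin n) ℝ}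
    (hY : IsLagrangian Y) {c : ℝ} (hc : IsUnit (shearLower c Y)) :
    (graphMatrix c Y).IsHermitian :=
  isHermitian_iff_transpose.mpr (hY.transpose_graphMatrix hc)

theorem rank_upper_eq {c : ℝ} {Y : Matrix (Fin n ⊕ Fin n) (Fin n) ℝ}
    (hc : IsUnit (shearLower c Y)) : (upper Y).rank = (graphMatrix c Y).rank := by
  rw [← graphMatrix_mul hc,
    rank_mul_eq_left_of_isUnit_det _ _ ((Matrix.isUnit_iff_isUnit_det _).mp hc)]

theorem wronskian_eq_mul_sub_mul {c : ℝ} {Y Z : Matrix (Fin n ⊕ Fin n) (Fin n) ℝ}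
    (hY : IsLagrangian Y) (hYc : IsUnit (shearLower c Y)) (hZc : IsUnit (shearLower c Z)) :
    wronskian Y Z
      = (shearLower c Y)ᵀ * (graphMatrix c Y - graphMatrix c Z) * shearLower c Z := by
  rw [wronskian_eq_shearLower c, Matrix.mul_sub, Matrix.sub_mul, Matrix.mul_assoc,
    Matrix.mul_assoc, graphMatrix_mul hZc, ← graphMatrix_mul hYc, transpose_mul,
    hY.transpose_graphMatrix hYc, Matrix.mul_assoc]

theorem rank_wronskian_eq {c : ℝ} {Y Z : Matrix (Fin n ⊕ Fin n) (Fin n) ℝ}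
    (hY : IsLagrangian Y) (hYc : IsUnit (shearLower c Y)) (hZc : IsUnit (shearLower c Z)) :
    (wronskian Y Z).rank = (graphMatrix c Y - graphMatrix c Z).rank := by
  rw [wronskian_eq_mul_sub_mul hY hYc hZc,
    rank_mul_eq_left_of_isUnit_det _ _ ((Matrix.isUnit_iff_isUnit_det _).mp hZc),
    rank_mul_eq_right_of_isUnit_det]
  rw [det_transpose]
  exact (Matrix.isUnit_iff_isUnit_det _).mp hYc

/-- `X†X` is the orthogonal projection onto the complement of `ker X`, and `ker (CX) = ker X`. -/
theorem pinv_mul_self_eq_of_isUnit {X C : Matrix (Fin n) (Fin n) ℝ} (hC : IsUnit C) :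
    pinv (C * X) * (C * X) = pinv X * X := by
  have hd := (Matrix.isUnit_iff_isUnit_det _).mp hC
  have hX := pinv_spec X
  have hS := pinv_spec (C * X)
  have h1 : X * (pinv (C * X) * (C * X)) = X := by
    have := congrArg (C⁻¹ * ·) hS.mul_mul_self
    simpa only [Matrix.mul_assoc, Matrix.nonsing_inv_mul_cancel_left _ _ hd] using this
  have h2 : (pinv (C * X) * (C * X)) * (pinv X * X) = pinv (C * X) * (C * X) := by
    rw [Matrix.mul_assoc, Matrix.mul_assoc C, ← Matrix.mul_assoc X, hX.mul_mul_self]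
  have h3 : (pinv X * X) * (pinv (C * X) * (C * X)) = pinv X * X := by
    rw [Matrix.mul_assoc, h1]
  have h4 := congrArg transpose h3
  rw [transpose_mul, hX.symm_right, hS.symm_right, h2] at h4
  exact h4

/-- The comparative index in terms of the symmetric matrices representing the two planes. -/
theorem comparativeIndex_add_negIndex {c : ℝ} {Y Z : Matrix (Fin n ⊕ Fin n) (Fin n) ℝ}
    (hY : IsLagrangian Y) (hZ : IsLagrangian Z)
    (hYc : IsUnit (shearLower c Y)) (hZc : IsUnit (shearLower c Z)) :
    comparativeIndex Y Z + negIndex (graphMatrix c Y)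
      = negIndex (graphMatrix c Y - graphMatrix c Z) + negIndex (graphMatrix c Z) := by
  have hYd := (Matrix.isUnit_iff_isUnit_det _).mp hYc
  set X := upper Y with hX
  set X' := upper Z with hX'
  set U := shearLower c Y with hU
  set U' := shearLower c Z with hU'
  set A := graphMatrix c Y with hA
  set B := graphMatrix c Z with hB
  have hAU : A * U = X := graphMatrix_mul hYc
  have hBU : B * U' = X' := graphMatrix_mul hZc
  have hAt : Aᵀ = A := hY.transpose_graphMatrix hYc
  have hBt : Bᵀ = B := hZ.transpose_graphMatrix hZc
  have hAh := hY.isHermitian_graphMatrix hYc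
  have hBh := hZ.isHermitian_graphMatrix hZc
  have hUt : IsUnit Uᵀ := by
    rw [Matrix.isUnit_iff_isUnit_det, det_transpose]; exact hYd
  -- The index of the block matrix with entries `S, N, Nᵀ, D` is computed twice: its Schur
  -- complement produces `compM` and `compP`, and a congruence brings it to `diag(A - B, B)`.
  set S := Uᵀ * X with hS
  set N := -(Uᵀ * X') with hN
  set D := U'ᵀ * X' with hD
  have hSA : S = Uᵀ * A * U := by rw [hS, ← hAU, Matrix.mul_assoc]
  have hNB : N = -(Uᵀ * B * U') := by rw [hN, ← hBU, Matrix.mul_assoc]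
  have hDB : D = U'ᵀ * B * U' := by rw [hD, ← hBU, Matrix.mul_assoc]
  have hSt : Sᵀ = S := by
    rw [hSA, transpose_mul, transpose_mul, transpose_transpose, hAt, Matrix.mul_assoc]
  have hDt : Dᵀ = D := by
    rw [hDB, transpose_mul, transpose_mul, transpose_transpose, hBt, Matrix.mul_assoc]
  have hNt : Nᵀ = -(X'ᵀ * U) := by
    rw [hN, transpose_neg, transpose_mul, transpose_transpose]
  have hW : wronskian Y Z = Xᵀ * U' + N := by
    rw [wronskian_eq_shearLower c, hN, sub_eq_add_neg]
  have hWt : (wronskian Y Z)ᵀ = U'ᵀ * X + Nᵀ := by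
    rw [hW, transpose_add, transpose_mul, transpose_transpose]
  have hproj : pinv S * S = pinv X * X := pinv_mul_self_eq_of_isUnit hUt
  -- The projection `1 - X†X` kills `Xᵀ`, so only the summand `N` of the Wronskian survives.
  have hM : compM Y Z = (1 - pinv S * S) * N := by
    have h1 : (1 - pinv X * X) * Xᵀ = 0 := by
      rw [Matrix.sub_mul, ← (pinv_spec X).symm_right, ← transpose_mul, ← Matrix.mul_assoc,
        (pinv_spec X).mul_mul_self, Matrix.one_mul, sub_self]
    rw [compM, ← hX, hW, Matrix.mul_add, ← Matrix.mul_assoc, h1, hproj, Matrix.zero_mul, zero_add]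
  set M := compM Y Z with hMdef
  have hV : compV Y Z = 1 - pinv M * M := rfl
  set V := compV Y Z with hVdef
  have hMV : M * V = 0 := by
    rw [hV, Matrix.mul_sub, ← Matrix.mul_assoc, (pinv_spec M).mul_mul_self]; simp
  have hNV : N * V = S * pinv S * N * V := by
    rw [hM, Matrix.sub_mul, Matrix.sub_mul, Matrix.one_mul, sub_eq_zero, pinv_mul_comm hSt] at hMV
    exact hMV
  -- On the range of `V` the block `X'` factors through `X`. This is what makes `X†` in `compP`
  -- expressible by `S†`.
  have hXV : X' * V = -(X * (pinv S * N * V)) := by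
    have h1 : U⁻¹ᵀ * Uᵀ = 1 := by
      rw [← transpose_mul, Matrix.mul_nonsing_inv _ hYd, transpose_one]
    have h2 : Uᵀ * (X' * V) = Uᵀ * -(X * (pinv S * N * V)) := by
      have h3 : -(Uᵀ * (X' * V)) = Uᵀ * (X * (pinv S * N * V)) := by
        calc -(Uᵀ * (X' * V)) = N * V := by rw [hN, Matrix.neg_mul, Matrix.mul_assoc]
          _ = S * pinv S * N * V := hNV
          _ = _ := by rw [hS]; simp only [Matrix.mul_assoc]
      rw [Matrix.mul_neg, ← h3, neg_neg]
    have h4 := congrArg (U⁻¹ᵀ * ·) h2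
    simpa only [← Matrix.mul_assoc U⁻¹ᵀ, h1, Matrix.one_mul] using h4
  have hP : compP Y Z = V * (D - Nᵀ * pinv S * N) * V := by
    have h1 : pinv X * X * pinv S = pinv S := by
      rw [← hproj, (pinv_spec S).mul_mul_inv]
    calc compP Y Z = V * (wronskian Y Z)ᵀ * pinv X * (X' * V) := by
          rw [compP, Matrix.mul_assoc]
      _ = -(V * (wronskian Y Z)ᵀ * ((pinv X * X * pinv S) * N * V)) := by
          rw [hXV, Matrix.mul_neg]; simp only [Matrix.mul_assoc]
      _ = V * U'ᵀ * -(X * (pinv S * N * V)) - V * (Nᵀ * pinv S * N) * V := by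
          rw [h1, hWt]; noncomm_ring
      _ = V * D * V - V * (Nᵀ * pinv S * N) * V := by
          rw [← hXV, hD]; simp only [Matrix.mul_assoc]
      _ = _ := by noncomm_ring
  have key := negIndex_fromBlocks (D := D) hSt hDt hM hV
  have hblock : negIndex (fromBlocks S N Nᵀ D) = negIndex (A - B) + negIndex B := by
    -- This is the substitution `(v, w) ↦ (Uv, U'w - Uv)`.
    set T : Matrix (Fin n ⊕ Fin n) (Fin n ⊕ Fin n) ℝ := fromBlocks U 0 (-U) U' with hT
    have hTu : IsUnit T := by
      rw [Matrix.isUnit_iff_isUnit_det, hT, det_fromBlocks_zero₁₂]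
      exact hYd.mul ((Matrix.isUnit_iff_isUnit_det _).mp hZc)
    have hdiag : (fromBlocks (A - B) 0 0 B).IsHermitian :=
      (hAh.sub hBh).fromBlocks (by simp) hBh
    have h1 : Tᵀ * fromBlocks (A - B) 0 0 B * T = fromBlocks S N Nᵀ D := by
      have hNt' : Nᵀ = -(U'ᵀ * B * U) := by rw [hNt, ← hBU, transpose_mul, hBt]
      rw [hT, fromBlocks_transpose, fromBlocks_multiply, fromBlocks_multiply, hNt', hSA, hNB, hDB]
      congr 1
      · simp only [transpose_neg]; noncomm_ring
      · simp only [transpose_neg]; noncomm_ring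
      · simp only [transpose_zero]; noncomm_ring
      · simp only [transpose_zero]; noncomm_ring
    rw [← h1, negIndex_transpose_mul_mul hdiag hTu, negIndex_fromBlocks_diagonal]
  have hSneg : negIndex S = negIndex A := by
    rw [hSA, negIndex_transpose_mul_mul hAh hYc]
  rw [← hblock, key, comparativeIndex, ind_eq_negIndex, hP, hSneg]
  ring

/-! ### Transversal planes -/

theorem transpose_mul_self_eq (Y : Matrix (Fin n ⊕ Fin n) (Fin n) ℝ) :
    Yᵀ * Y = (upper Y)ᵀ * upper Y + (lower Y)ᵀ * lower Y := by
  have hY : Y = fromRows (upper Y) (lower Y) := (fromRows_toRows Y).symm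
  conv_lhs => rw [hY, transpose_fromRows, fromCols_mul_fromRows]

theorem IsLagrangian.isUnit_transpose_mul_self {Y : Matrix (Fin n ⊕ Fin n) (Fin n) ℝ}
    (hY : IsLagrangian Y) : IsUnit (Yᵀ * Y) := by
  rw [Matrix.isUnit_iff_isUnit_det, isUnit_iff_ne_zero]
  intro h
  have h1 : (Yᵀ * Y).rank = n := by rw [rank_transpose_mul_self, hY.2]
  obtain ⟨v, hv, hv0⟩ := Matrix.exists_mulVec_eq_zero_iff.mpr h
  have h2 : (Yᵀ * Y).rank < n := by
    have h3 := LinearMap.finrank_range_add_finrank_ker (Yᵀ * Y).mulVecLin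
    have h4 : 0 < Module.finrank ℝ (LinearMap.ker (Yᵀ * Y).mulVecLin) := by
      rw [Module.finrank_pos_iff_exists_ne_zero]
      exact ⟨⟨v, hv0⟩, fun h0 => hv (congrArg Subtype.val h0)⟩
    simp only [Module.finrank_fin_fun] at h3
    rw [Matrix.rank]
    omega
  omega

/-- `(X - iU)ᵀ (X + iU) = XᵀX + UᵀU`, since the cross terms cancel by symmetry of `XᵀU`; the
right-hand side is invertible by full rank. -/
theorem IsLagrangian.isUnit_plusI {Y : Matrix (Fin n ⊕ Fin n) (Fin n) ℝ}
    (hY : IsLagrangian Y) : IsUnit (plusI Y) := by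
  have hmap : ∀ P Q : Matrix (Fin n) (Fin n) ℝ,
      P.map Complex.ofReal * Q.map Complex.ofReal = (P * Q).map Complex.ofReal :=
    fun P Q => (Matrix.map_mul (f := Complex.ofRealHom)).symm
  have h1 : ((upper Y).map Complex.ofReal - Complex.I • (lower Y).map Complex.ofReal)ᵀ * plusI Y
      = (Yᵀ * Y).map Complex.ofReal := by
    rw [transpose_mul_self_eq, plusI, transpose_sub, transpose_smul, ← transpose_map, ← transpose_map]
    simp only [Matrix.sub_mul, Matrix.mul_add, Matrix.smul_mul, Matrix.mul_smul, hmap,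
      hY.transpose_upper_mul_lower]
    rw [Matrix.map_add _ Complex.ofReal_add, smul_sub, smul_smul, Complex.I_mul_I, neg_one_smul]
    abel
  have h2 : IsUnit ((Yᵀ * Y).map Complex.ofReal) :=
    hY.isUnit_transpose_mul_self.map (Complex.ofRealHom.mapMatrix (m := Fin n))
  rw [← h1] at h2
  rw [Matrix.isUnit_iff_isUnit_det, det_mul] at h2
  rw [Matrix.isUnit_iff_isUnit_det]
  exact isUnit_of_mul_isUnit_right h2

/-- `det (U + cX)` is a polynomial in `c`. It is not zero, because at `c = -i` it equals `det (-i (X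
+ iU))`. -/
theorem IsLagrangian.finite_not_isUnit_shearLower {Y : Matrix (Fin n ⊕ Fin n) (Fin n) ℝ}
    (hY : IsLagrangian Y) : {c : ℝ | ¬ IsUnit (shearLower c Y)}.Finite := by
  let p : Polynomial ℝ :=
    ((lower Y).map Polynomial.C + (Polynomial.X : Polynomial ℝ) • (upper Y).map Polynomial.C).det
  have hp : ∀ c : ℝ, p.eval c = (shearLower c Y).det := by
    intro c
    rw [← Polynomial.coe_evalRingHom, RingHom.map_det, shearLower]
    congr 1
    ext i j
    simp only [RingHom.mapMatrix_apply, Matrix.map_apply, Matrix.add_apply, Matrix.smul_apply,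
      smul_eq_mul, Polynomial.coe_evalRingHom, Polynomial.eval_add, Polynomial.eval_mul,
      Polynomial.eval_C, Polynomial.eval_X]
  have hpI : p.eval₂ Complex.ofRealHom (-Complex.I) = ((-Complex.I) • plusI Y).det := by
    rw [← Polynomial.coe_eval₂RingHom, RingHom.map_det, plusI]
    congr 1
    ext i j
    simp only [RingHom.mapMatrix_apply, Matrix.map_apply, Matrix.add_apply, Matrix.smul_apply,
      smul_eq_mul, Polynomial.coe_eval₂RingHom, Polynomial.eval₂_add, Polynomial.eval₂_mul,
      Polynomial.eval₂_C, Polynomial.eval₂_X, Complex.ofRealHom_eq_coe]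
    linear_combination (lower Y i j : ℂ) * Complex.I_mul_I
  have hp0 : p ≠ 0 := by
    intro h0
    rw [h0, Polynomial.eval₂_zero, det_smul] at hpI
    have := (Matrix.isUnit_iff_isUnit_det _).mp hY.isUnit_plusI
    have h3 := mul_ne_zero (pow_ne_zero (Fintype.card (Fin n))
      (neg_ne_zero.mpr Complex.I_ne_zero)) this.ne_zero
    exact h3 hpI.symm
  refine (Polynomial.finite_setOfPred_isRoot hp0).subset ?_
  intro c hc
  simp only [Set.mem_ofPred_eq, Matrix.isUnit_iff_isUnit_det, isUnit_iff_ne_zero, not_not] at hc ⊢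
  rw [Polynomial.IsRoot, hp, hc]

theorem exists_pos_isUnit_shearLower {Y Z : Matrix (Fin n ⊕ Fin n) (Fin n) ℝ}
    (hY : IsLagrangian Y) (hZ : IsLagrangian Z) :
    ∃ c : ℝ, 0 < c ∧ IsUnit (shearLower c Y) ∧ IsUnit (shearLower c Z) := by
  have hfin := hY.finite_not_isUnit_shearLower.union hZ.finite_not_isUnit_shearLower
  obtain ⟨c, hc, hc'⟩ := (Set.Ioi_infinite (0 : ℝ)).exists_notMem_finite hfin
  simp only [Set.mem_union, Set.mem_ofPred_eq, not_or, not_not] at hc'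
  exact ⟨c, hc, hc'.1, hc'.2⟩

/-- The two signs serve the two points `e^{i(π±ε)}` that a Maslov system has to avoid. -/
theorem IsLagrangian.exists_pos_isUnit_shearLower_neg {Y : Matrix (Fin n ⊕ Fin n) (Fin n) ℝ}
    (hY : IsLagrangian Y) :
    ∃ c : ℝ, 0 < c ∧ IsUnit (shearLower c Y) ∧ IsUnit (shearLower (-c) Y) := by
  have hfin := hY.finite_not_isUnit_shearLower.union
    (hY.finite_not_isUnit_shearLower.preimage neg_injective.injOn)
  obtain ⟨c, hc, hc'⟩ := (Set.Ioi_infinite (0 : ℝ)).exists_notMem_finite hfin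
  simp only [Set.mem_union, Set.mem_preimage, Set.mem_ofPred_eq, not_or, not_not] at hc'
  exact ⟨c, hc, hc'.1, hc'.2⟩

/-! ### The eigenvalues of `Γ` -/

/-- The matrix `cos (θ / 2) X - sin (θ / 2) U`. -/
def rotUpper (θ : ℝ) (Y : Matrix (Fin n ⊕ Fin n) (Fin n) ℝ) : Matrix (Fin n) (Fin n) ℝ :=
  Real.cos (θ / 2) • upper Y - Real.sin (θ / 2) • lower Y

theorem Gam_vertical (Y : Matrix (Fin n ⊕ Fin n) (Fin n) ℝ) :
    Gam (vertical n) Y = minusI Y * (plusI Y)⁻¹ := by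
  have h1 : plusI (vertical n) = Complex.I • (1 : Matrix (Fin n) (Fin n) ℂ) := by
    simp [plusI, vertical, upper, lower]
  have h2 : (minusI (vertical n))⁻¹ = Complex.I • (1 : Matrix (Fin n) (Fin n) ℂ) := by
    apply Matrix.inv_eq_right_inv
    simp [minusI, vertical, upper, lower, smul_smul]
  rw [Gam, h1, h2]
  simp [smul_smul]

/-- Here `Γ = (X - iU)(X + iU)⁻¹`. Extracting `e^{iθ/2}` from `(X - iU) + e^{iθ}(X + iU)` leaves
twice a real matrix, which explains the half angles. -/
theorem GamShift_vertical {Y : Matrix (Fin n ⊕ Fin n) (Fin n) ℝ} (hY : IsLagrangian Y) (θ : ℝ) :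
    GamShift (vertical n) Y θ = (2 * Complex.exp (Complex.I * (θ / 2 : ℝ)))
      • ((rotUpper θ Y).map Complex.ofReal * (plusI Y)⁻¹) := by
  have hd := (Matrix.isUnit_iff_isUnit_det _).mp hY.isUnit_plusI
  have h1 : GamShift (vertical n) Y θ
      = (minusI Y + Complex.exp (Complex.I * θ) • plusI Y) * (plusI Y)⁻¹ := by
    have he : Complex.exp (Complex.I * ((Real.pi + θ : ℝ) : ℂ)) = -Complex.exp (Complex.I * θ) := by
      have : Complex.I * ((Real.pi + θ : ℝ) : ℂ) = Real.pi * Complex.I + Complex.I * θ := by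
        push_cast; ring
      rw [this, Complex.exp_add, Complex.exp_pi_mul_I, neg_one_mul]
    rw [GamShift, Gam_vertical, he, Matrix.add_mul, Matrix.smul_mul, Matrix.mul_nonsing_inv _ hd,
      neg_smul, sub_neg_eq_add]
  have h2 : minusI Y + Complex.exp (Complex.I * θ) • plusI Y
      = (2 * Complex.exp (Complex.I * (θ / 2 : ℝ))) • (rotUpper θ Y).map Complex.ofReal := by
    set e := Complex.exp (Complex.I * (θ / 2 : ℝ)) with he
    have hee : Complex.exp (Complex.I * θ) = e * e := by
      rw [he, ← Complex.exp_add]; congr 1; push_cast; ring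
    have hecs : e = Real.cos (θ / 2) + Real.sin (θ / 2) * Complex.I := by
      rw [he, mul_comm, Complex.exp_mul_I]; push_cast; rfl
    have hsc : (Real.sin (θ / 2) : ℂ) ^ 2 + (Real.cos (θ / 2) : ℂ) ^ 2 = 1 := by
      exact_mod_cast Real.sin_sq_add_cos_sq (θ / 2)
    ext i j
    simp only [minusI, plusI, rotUpper, Matrix.add_apply, Matrix.sub_apply, Matrix.smul_apply,
      Matrix.map_apply, smul_eq_mul, hee, hecs, Complex.ofReal_sub, Complex.ofReal_mul]
    have hI := Complex.I_sq
    generalize (Real.sin (θ / 2) : ℂ) = s at *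
    generalize (Real.cos (θ / 2) : ℂ) = k at *
    generalize ((upper Y i j : ℝ) : ℂ) = x
    generalize ((lower Y i j : ℝ) : ℂ) = u
    linear_combination (-(x - Complex.I * u)) * hsc +
      (s ^ 2 * (x + Complex.I * u) + 2 * k * s * u) * hI
  rw [h1, h2, Matrix.smul_mul]

theorem isUnit_map_ofReal_iff {A : Matrix (Fin n) (Fin n) ℝ} :
    IsUnit (A.map Complex.ofReal) ↔ IsUnit A := by
  have h : (A.map Complex.ofReal).det = (A.det : ℂ) :=
    (RingHom.map_det Complex.ofRealHom A).symm
  rw [Matrix.isUnit_iff_isUnit_det, Matrix.isUnit_iff_isUnit_det, h, isUnit_iff_ne_zero,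
    isUnit_iff_ne_zero, Complex.ofReal_ne_zero]

theorem isUnit_GamShift_iff {Y : Matrix (Fin n ⊕ Fin n) (Fin n) ℝ} (hY : IsLagrangian Y) (θ : ℝ) :
    IsUnit (GamShift (vertical n) Y θ) ↔ IsUnit (rotUpper θ Y) := by
  have hd := (Matrix.isUnit_iff_isUnit_det _).mp hY.isUnit_plusI
  rw [GamShift_vertical hY, ← isUnit_map_ofReal_iff, Matrix.isUnit_iff_isUnit_det,
    Matrix.isUnit_iff_isUnit_det, det_smul, det_mul]
  have hc : IsUnit ((2 * Complex.exp (Complex.I * (θ / 2 : ℝ))) ^ Fintype.card (Fin n)) :=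
    (isUnit_iff_ne_zero.mpr (mul_ne_zero two_ne_zero (Complex.exp_ne_zero _))).pow _
  rw [IsUnit.mul_iff, IsUnit.mul_iff, and_iff_right hc,
    and_iff_left (isUnit_nonsing_inv_det_iff.mpr hd)]

theorem defect_add_rank (A : Matrix (Fin n) (Fin n) ℂ) : defect A + A.rank = n := by
  have := LinearMap.finrank_range_add_finrank_ker A.mulVecLin
  simp only [Module.finrank_fin_fun] at this
  rw [defect, Matrix.rank]
  omega

/-- Needed because defects are taken over `ℂ` while the graph matrices are real. The rank normal
form survives extension of scalars. -/
theorem rank_map_ofReal (A : Matrix (Fin n) (Fin n) ℝ) :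
    (A.map Complex.ofReal).rank = A.rank := by
  obtain ⟨V, U, e, hV, hU, h⟩ := A.exists_rank_normal_form
  have hdiag : ((fromBlocks 1 0 0 0 : Matrix (Fin A.rank ⊕ Fin (Fintype.card (Fin n) - A.rank))
      (Fin A.rank ⊕ Fin (Fintype.card (Fin n) - A.rank)) ℝ)).submatrix e e
      = diagonal (Sum.elim 1 0 ∘ e) := by
    rw [← diagonal_one, ← diagonal_zero, fromBlocks_diagonal, submatrix_diagonal_equiv]
    rfl
  rw [hdiag] at h
  have h' : V.map Complex.ofReal * A.map Complex.ofReal * U.map Complex.ofReal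
      = diagonal (Complex.ofReal ∘ (Sum.elim 1 0 ∘ e)) := by
    have := congrArg (fun B => B.map (Complex.ofRealHom : ℝ → ℂ)) h
    simp only [Matrix.map_mul, diagonal_map (map_zero Complex.ofRealHom)] at this
    exact this
  have hd : ∀ {B : Matrix (Fin n) (Fin n) ℝ}, IsUnit B → IsUnit (B.map Complex.ofReal).det :=
    fun hB => (Matrix.isUnit_iff_isUnit_det _).mp (isUnit_map_ofReal_iff.mpr hB)
  have h1 : (A.map Complex.ofReal).rank = (diagonal (Complex.ofReal ∘ (Sum.elim 1 0 ∘ e))).rank := by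
    rw [← h', rank_mul_eq_left_of_isUnit_det _ _ (hd hU),
      rank_mul_eq_right_of_isUnit_det _ _ (hd hV)]
  have h2 : A.rank = (diagonal (Sum.elim 1 0 ∘ e : Fin n → ℝ)).rank := by
    rw [← h, rank_mul_eq_left_of_isUnit_det _ _ ((Matrix.isUnit_iff_isUnit_det _).mp hU),
      rank_mul_eq_right_of_isUnit_det _ _ ((Matrix.isUnit_iff_isUnit_det _).mp hV)]
  refine h1.trans (Eq.trans ?_ h2.symm)
  rw [rank_diagonal, rank_diagonal]
  simp

theorem defect_GamShift {Y : Matrix (Fin n ⊕ Fin n) (Fin n) ℝ} (hY : IsLagrangian Y) (θ : ℝ) :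
    defect (GamShift (vertical n) Y θ) + (rotUpper θ Y).rank = n := by
  have hd := (Matrix.isUnit_iff_isUnit_det _).mp hY.isUnit_plusI
  have := defect_add_rank (GamShift (vertical n) Y θ)
  rw [GamShift_vertical hY] at this ⊢
  rwa [rank_smul_of_mem_nonZeroDivisors _ (mem_nonZeroDivisors_of_ne_zero
    (mul_ne_zero two_ne_zero (Complex.exp_ne_zero _))), rank_mul_eq_left_of_isUnit_det _ _
    (isUnit_nonsing_inv_det_iff.mpr hd), rank_map_ofReal] at this

theorem rank_sub_smul_one {A : Matrix (Fin n) (Fin n) ℝ} (hA : A.IsHermitian) (c : ℝ) :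
    {i | hA.eigenvalues i = c}.ncard + (A - c • 1).rank = n := by
  have hO : IsUnit (hA.eigenvectorUnitary : Matrix (Fin n) (Fin n) ℝ).det :=
    (Matrix.isUnit_iff_isUnit_det _).mp (Unitary.toUnits hA.eigenvectorUnitary).isUnit
  have hO' : IsUnit (star (hA.eigenvectorUnitary : Matrix (Fin n) (Fin n) ℝ)).det :=
    (Matrix.isUnit_iff_isUnit_det _).mp (Unitary.toUnits (star hA.eigenvectorUnitary)).isUnit
  have h1 : star (hA.eigenvectorUnitary : Matrix (Fin n) (Fin n) ℝ) * (A - c • 1)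
      * (hA.eigenvectorUnitary : Matrix (Fin n) (Fin n) ℝ)
      = diagonal (fun i => hA.eigenvalues i - c) := by
    have h2 := hA.conjStarAlgAut_star_eigenvectorUnitary
    rw [Unitary.conjStarAlgAut_star_apply] at h2
    rw [Matrix.mul_sub, Matrix.sub_mul, h2, Matrix.mul_smul, Matrix.mul_one, Matrix.smul_mul,
      Unitary.coe_star_mul_self, smul_one_eq_diagonal, diagonal_sub]
    rfl
  rw [← rank_mul_eq_right_of_isUnit_det _ _ hO', ← rank_mul_eq_left_of_isUnit_det _ _ hO, h1,
    rank_diagonal, ← Nat.card_eq_fintype_card]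
  have h3 := Set.ncard_add_ncard_compl {i | hA.eigenvalues i = c}
  rw [Nat.card_eq_fintype_card, Fintype.card_fin] at h3
  refine Eq.trans (congrArg _ ?_) h3
  rw [← Nat.card_coe_set_eq {i | hA.eigenvalues i = c}ᶜ]
  exact Nat.card_congr (Equiv.subtypeEquivRight fun i => not_congr sub_eq_zero)

/-- The eigenvalue of `graphMatrix c Y` corresponding to the eigenvalue `exp (i (π + θ))`
of `Γ`. -/
def angleToSlope (c θ : ℝ) : ℝ := Real.sin (θ / 2) / (Real.cos (θ / 2) + c * Real.sin (θ / 2))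

theorem angleToSlope_denom_pos {c θ : ℝ} (hc : 0 < c) (hθ : θ ∈ Set.Ico 0 Real.pi) :
    0 < Real.cos (θ / 2) + c * Real.sin (θ / 2) := by
  have h1 : 0 < Real.cos (θ / 2) :=
    Real.cos_pos_of_mem_Ioo ⟨by linarith [hθ.1, Real.pi_pos], by linarith [hθ.2]⟩
  have h2 : 0 ≤ Real.sin (θ / 2) :=
    Real.sin_nonneg_of_nonneg_of_le_pi (by linarith [hθ.1]) (by linarith [hθ.2, Real.pi_pos])
  positivity

/-- After cross-multiplication the terms with `c` cancel, and `sin (φ/2 - θ/2) > 0` remains. -/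
theorem strictMonoOn_angleToSlope {c : ℝ} (hc : 0 < c) :
    StrictMonoOn (angleToSlope c) (Set.Ico 0 Real.pi) := by
  intro θ hθ φ hφ hlt
  rw [angleToSlope, angleToSlope,
    div_lt_div_iff₀ (angleToSlope_denom_pos hc hθ) (angleToSlope_denom_pos hc hφ)]
  have h : 0 < Real.sin (φ / 2 - θ / 2) :=
    Real.sin_pos_of_pos_of_lt_pi (by linarith) (by linarith [hθ.1, hφ.2, Real.pi_pos])
  rw [Real.sin_sub] at h
  nlinarith

theorem continuousOn_angleToSlope {c : ℝ} (hc : 0 < c) :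
    ContinuousOn (angleToSlope c) (Set.Ico 0 Real.pi) := by
  unfold angleToSlope
  refine ContinuousOn.div (by fun_prop) (by fun_prop) fun θ hθ => ?_
  exact (angleToSlope_denom_pos hc hθ).ne'

/-- Write `cos · X - sin · U = (cos + c sin) X - sin · (U + cX)` and substitute `X = A (U + cX)`. -/
theorem rotUpper_eq {c θ : ℝ} (hc : 0 < c) (hθ : θ ∈ Set.Ico 0 Real.pi)
    {Y : Matrix (Fin n ⊕ Fin n) (Fin n) ℝ} (hYc : IsUnit (shearLower c Y)) :
    rotUpper θ Y = (Real.cos (θ / 2) + c * Real.sin (θ / 2)) •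
      ((graphMatrix c Y - angleToSlope c θ • 1) * shearLower c Y) := by
  have hpos := angleToSlope_denom_pos hc hθ
  rw [Matrix.sub_mul, graphMatrix_mul hYc, angleToSlope, smul_sub, Matrix.smul_mul, smul_smul,
    mul_div_cancel₀ _ hpos.ne', Matrix.one_mul, rotUpper, shearLower]
  module

theorem defect_GamShift_eq_ncard {c θ : ℝ} (hc : 0 < c) (hθ : θ ∈ Set.Ico 0 Real.pi)
    {Y : Matrix (Fin n ⊕ Fin n) (Fin n) ℝ} (hY : IsLagrangian Y)
    (hYc : IsUnit (shearLower c Y)) :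
    defect (GamShift (vertical n) Y θ)
      = {i | (hY.isHermitian_graphMatrix hYc).eigenvalues i = angleToSlope c θ}.ncard := by
  have h1 := defect_GamShift hY θ
  have h2 := rank_sub_smul_one (hY.isHermitian_graphMatrix hYc) (angleToSlope c θ)
  rw [rotUpper_eq hc hθ hYc, rank_smul_of_mem_nonZeroDivisors _ (mem_nonZeroDivisors_of_ne_zero
    (angleToSlope_denom_pos hc hθ).ne'), rank_mul_eq_left_of_isUnit_det _ _
    ((Matrix.isUnit_iff_isUnit_det _).mp hYc)] at h1
  omega

/-- The function `ℓ` counts the eigenvalues of the graph matrix in an interval `[0, λ)`. -/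
theorem ell_eq_ncard {c ε : ℝ} (hc : 0 < c) (hε : ε ∈ Set.Ioo 0 Real.pi)
    {Y : Matrix (Fin n ⊕ Fin n) (Fin n) ℝ} (hY : IsLagrangian Y)
    (hYc : IsUnit (shearLower c Y)) :
    ell (vertical n) Y ε = {i | (hY.isHermitian_graphMatrix hYc).eigenvalues i ∈
      Set.Ico 0 (angleToSlope c ε)}.ncard := by
  classical
  set ev := (hY.isHermitian_graphMatrix hYc).eigenvalues with hev
  have hsub : Set.Ico 0 ε ⊆ Set.Ico 0 Real.pi := Set.Ico_subset_Ico_right hε.2.le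
  have hεmem : ε ∈ Set.Ico 0 Real.pi := ⟨hε.1.le, hε.2⟩
  have hmono := strictMonoOn_angleToSlope hc
  have h0 : angleToSlope c 0 = 0 := by simp [angleToSlope]
  have h0mem : (0 : ℝ) ∈ Set.Ico 0 Real.pi := ⟨le_rfl, Real.pi_pos⟩
  have hivt : Set.Ico 0 (angleToSlope c ε) ⊆ angleToSlope c '' Set.Ico 0 ε := by
    have := intermediate_value_Ico hε.1.le
      ((continuousOn_angleToSlope hc).mono (Set.Icc_subset_Ico_right hε.2))
    rwa [h0] at this
  let I : Finset (Fin n) := Finset.univ.filter fun i => ev i ∈ Set.Ico 0 (angleToSlope c ε)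
  -- Each eigenvalue in the range gets its angle by the intermediate value theorem; `0` is a dummy
  -- angle for the other indices. The sum defining `ell` is then the count of `I` by the fibres of
  -- `g`.
  have hex : ∀ i, ∃ θ, i ∈ I → θ ∈ Set.Ico 0 ε ∧ angleToSlope c θ = ev i := by
    intro i
    by_cases hi : i ∈ I
    · obtain ⟨θ, h1, h2⟩ := hivt (Finset.mem_filter.mp hi).2
      exact ⟨θ, fun _ => ⟨h1, h2⟩⟩
    · exact ⟨0, fun h => absurd h hi⟩
  choose g hg using hex
  have hcount : ∀ θ ∈ Set.Ico 0 ε, defect (GamShift (vertical n) Y θ)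
      = (I.filter fun i => g i = θ).card := by
    intro θ hθ
    rw [defect_GamShift_eq_ncard hc (hsub hθ) hY hYc, Set.ncard_eq_toFinset_card']
    congr 1
    ext i
    simp only [Set.mem_toFinset, Set.mem_ofPred_eq, Finset.mem_filter, ← hev]
    constructor
    · intro h
      have hi : i ∈ I := by
        refine Finset.mem_filter.mpr ⟨Finset.mem_univ _, ?_⟩
        rw [h]
        refine ⟨?_, hmono (hsub hθ) hεmem hθ.2⟩
        rw [← h0]
        exact hmono.monotoneOn h0mem (hsub hθ) hθ.1
      refine ⟨hi, hmono.injOn (hsub (hg i hi).1) (hsub hθ) ?_⟩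
      rw [(hg i hi).2, h]
    · rintro ⟨hi, rfl⟩
      exact (hg i hi).2.symm
  rw [ell, finsum_mem_eq_sum_of_inter_support_eq (t := I.image g), Set.ncard_eq_toFinset_card']
  · have hI : {i | ev i ∈ Set.Ico 0 (angleToSlope c ε)}.toFinset = I := by
      ext i; simp [I]
    rw [hI, Finset.card_eq_sum_card_image g I]
    refine Finset.sum_congr rfl fun θ hθ => ?_
    obtain ⟨i, hi, rfl⟩ := Finset.mem_image.mp hθ
    exact hcount _ (hg i hi).1
  · ext θ
    simp only [Set.mem_inter_iff, Function.mem_support, Finset.mem_coe, Finset.mem_image]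
    constructor
    · rintro ⟨hθ, hne⟩
      rw [hcount θ hθ, Finset.card_ne_zero] at hne
      obtain ⟨i, hi⟩ := hne
      obtain ⟨hi, hgi⟩ := Finset.mem_filter.mp hi
      refine ⟨⟨i, hi, hgi⟩, ?_⟩
      rw [hcount θ hθ, Finset.card_ne_zero]
      exact ⟨i, Finset.mem_filter.mpr ⟨hi, hgi⟩⟩
    · rintro ⟨⟨i, hi, rfl⟩, hne⟩
      exact ⟨(hg i hi).1, hne⟩

theorem ell_add_negIndex {c ε : ℝ} (hc : 0 < c) (hε : ε ∈ Set.Ioo 0 Real.pi)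
    {Y : Matrix (Fin n ⊕ Fin n) (Fin n) ℝ} (hY : IsLagrangian Y)
    (hYc : IsUnit (shearLower c Y)) :
    ell (vertical n) Y ε + negIndex (graphMatrix c Y)
      = negIndex (graphMatrix c Y - angleToSlope c ε • 1) := by
  have h0 : 0 < angleToSlope c ε := by
    have := strictMonoOn_angleToSlope hc ⟨le_rfl, Real.pi_pos⟩ ⟨hε.1.le, hε.2⟩ hε.1
    simpa [angleToSlope] using this
  rw [ell_eq_ncard hc hε hY hYc, negIndex_eq_ncard (hY.isHermitian_graphMatrix hYc),
    negIndex_sub_smul_one (hY.isHermitian_graphMatrix hYc), ← Set.ncard_union_eq]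
  · congr 1
    ext i
    simp only [Set.mem_union, Set.mem_ofPred_eq, Set.mem_Ico]
    constructor
    · rintro (h | h)
      · exact h.2
      · exact h.trans h0
    · intro h
      rcases lt_or_ge ((hY.isHermitian_graphMatrix hYc).eigenvalues i) 0 with h1 | h1
      · exact Or.inr h1
      · exact Or.inl ⟨h1, h⟩
  · rw [Set.disjoint_left]
    intro i hi hi'
    exact absurd hi.1 (not_le.mpr hi')

theorem isUnit_graphMatrix_sub {c ε : ℝ} (hc : 0 < c) (hε : ε ∈ Set.Ioo 0 Real.pi)
    {Y : Matrix (Fin n ⊕ Fin n) (Fin n) ℝ} (hY : IsLagrangian Y)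
    (hYc : IsUnit (shearLower c Y)) (h : IsUnit (GamShift (vertical n) Y ε)) :
    IsUnit (graphMatrix c Y - angleToSlope c ε • 1) := by
  rw [isUnit_GamShift_iff hY, rotUpper_eq hc ⟨hε.1.le, hε.2⟩ hYc, Matrix.isUnit_iff_isUnit_det,
    det_smul, det_mul] at h
  rw [Matrix.isUnit_iff_isUnit_det]
  exact isUnit_of_mul_isUnit_left (isUnit_of_mul_isUnit_right h)

/-! ### Local comparison of the comparative index with `ℓ` -/

open Filter Topology

theorem continuous_shearLower (c : ℝ) :
    Continuous (shearLower c : Matrix (Fin n ⊕ Fin n) (Fin n) ℝ → Matrix (Fin n) (Fin n) ℝ) := by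
  unfold shearLower upper lower
  refine Continuous.add ?_ (Continuous.const_smul ?_ c)
  · exact continuous_pi fun i => continuous_pi fun j => continuous_apply_apply _ _
  · exact continuous_pi fun i => continuous_pi fun j => continuous_apply_apply _ _

theorem continuous_upper :
    Continuous (upper : Matrix (Fin n ⊕ Fin n) (Fin n) ℝ → Matrix (Fin n) (Fin n) ℝ) :=
  continuous_pi fun _ => continuous_pi fun _ => continuous_apply_apply _ _

theorem eventually_isUnit_shearLower {c : ℝ} {Y₀ : Matrix (Fin n ⊕ Fin n) (Fin n) ℝ}
    (h : IsUnit (shearLower c Y₀)) : ∀ᶠ Y in 𝓝 Y₀, IsUnit (shearLower c Y) := by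
  simp only [Matrix.isUnit_iff_isUnit_det, isUnit_iff_ne_zero] at h ⊢
  exact (continuous_shearLower c).matrix_det.continuousAt.eventually_ne h

theorem continuousAt_graphMatrix {c : ℝ} {Y₀ : Matrix (Fin n ⊕ Fin n) (Fin n) ℝ}
    (h : IsUnit (shearLower c Y₀)) : ContinuousAt (graphMatrix c) Y₀ := by
  rw [Matrix.isUnit_iff_isUnit_det, isUnit_iff_ne_zero] at h
  unfold graphMatrix
  simp only [Matrix.inv_def, Ring.inverse_eq_inv']
  have h1 : ContinuousAt (fun Y => (shearLower c Y).det⁻¹) Y₀ :=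
    (continuous_shearLower c).matrix_det.continuousAt.inv₀ h
  have h2 : ContinuousAt (fun Y => (shearLower c Y).adjugate) Y₀ :=
    (continuous_shearLower c).matrix_adjugate.continuousAt
  exact continuous_upper.continuousAt.mul (h1.smul h2)

theorem eventually_comparativeIndex_sub_ell_eq {T : Set ℝ} {t₀ ε : ℝ} (ht₀ : t₀ ∈ T)
    {Y Z : ℝ → Matrix (Fin n ⊕ Fin n) (Fin n) ℝ}
    (hYc : ContinuousOn Y T) (hZc : ContinuousOn Z T)
    (hY : ∀ s ∈ T, IsLagrangian (Y s)) (hZ : ∀ s ∈ T, IsLagrangian (Z s))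
    (hW : ∃ r : ℕ, ∀ s ∈ T, (wronskian (Z s) (Y s)).rank = r)
    (hX : ∃ r : ℕ, ∀ s ∈ T, (upper (Z s)).rank = r)
    (hε : ε ∈ Set.Ioo 0 Real.pi) (hu : IsUnit (GamShift (vertical n) (Y t₀) ε)) :
    ∀ᶠ s in 𝓝[T] t₀,
      (comparativeIndex (Y s) (Z s) : ℤ) - (ell (vertical n) (Y s) ε : ℤ)
        = (comparativeIndex (Y t₀) (Z t₀) : ℤ) - (ell (vertical n) (Y t₀) ε : ℤ) := by
  obtain ⟨c, hc, hcY, hcZ⟩ := exists_pos_isUnit_shearLower (hY t₀ ht₀) (hZ t₀ ht₀)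
  have hYlim : Tendsto Y (𝓝[T] t₀) (𝓝 (Y t₀)) := hYc t₀ ht₀
  have hZlim : Tendsto Z (𝓝[T] t₀) (𝓝 (Z t₀)) := hZc t₀ ht₀
  have hYu := hYlim.eventually (eventually_isUnit_shearLower hcY)
  have hZu := hZlim.eventually (eventually_isUnit_shearLower hcZ)
  have hA : Tendsto (fun s => graphMatrix c (Y s)) (𝓝[T] t₀) (𝓝 (graphMatrix c (Y t₀))) :=
    (continuousAt_graphMatrix hcY).tendsto.comp hYlim
  have hB : Tendsto (fun s => graphMatrix c (Z s)) (𝓝[T] t₀) (𝓝 (graphMatrix c (Z t₀))) :=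
    (continuousAt_graphMatrix hcZ).tendsto.comp hZlim
  have hT : ∀ᶠ s in 𝓝[T] t₀, s ∈ T := self_mem_nhdsWithin
  have hAh : ∀ᶠ s in 𝓝[T] t₀, (graphMatrix c (Y s)).IsHermitian := by
    filter_upwards [hT, hYu] with s hs hsu using (hY s hs).isHermitian_graphMatrix hsu
  have hBh : ∀ᶠ s in 𝓝[T] t₀, (graphMatrix c (Z s)).IsHermitian := by
    filter_upwards [hT, hZu] with s hs hsu using (hZ s hs).isHermitian_graphMatrix hsu
  have hA₀ := (hY t₀ ht₀).isHermitian_graphMatrix hcY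
  have hB₀ := (hZ t₀ ht₀).isHermitian_graphMatrix hcZ
  obtain ⟨r, hr⟩ := hW
  obtain ⟨r', hr'⟩ := hX
  have hneg : ∀ P Q : Matrix (Fin n) (Fin n) ℝ, (P - Q).rank = (Q - P).rank := by
    intro P Q
    have h1 : P - Q = (-1 : ℝ) • (Q - P) := by simp
    rw [h1, rank_smul_of_mem_nonZeroDivisors _ (mem_nonZeroDivisors_of_ne_zero (by norm_num))]
  have h1 := eventually_negIndex_eq hB hB₀ hBh (by
    filter_upwards [hT, hZu] with s hs hsu
    rw [← rank_upper_eq hsu, ← rank_upper_eq hcZ, hr' s hs, hr' t₀ ht₀])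
  have h2 := eventually_negIndex_eq (hA.sub hB) (hA₀.sub hB₀)
    (by filter_upwards [hAh, hBh] with s h1 h2 using h1.sub h2) (by
    filter_upwards [hT, hYu, hZu] with s hs hsY hsZ
    rw [hneg, ← rank_wronskian_eq (hZ s hs) hsZ hsY, hr s hs, hneg,
      ← rank_wronskian_eq (hZ t₀ ht₀) hcZ hcY, hr t₀ ht₀])
  have hS : ((angleToSlope c ε) • (1 : Matrix (Fin n) (Fin n) ℝ)).IsHermitian := by
    rw [isHermitian_iff_transpose]; simp
  have hu₀ := isUnit_graphMatrix_sub hc hε (hY t₀ ht₀) hcY hu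
  have hlim3 := hA.sub (tendsto_const_nhds (x := (angleToSlope c ε) •
    (1 : Matrix (Fin n) (Fin n) ℝ)))
  have hu₁ : ∀ᶠ s in 𝓝[T] t₀,
      IsUnit (graphMatrix c (Y s) - angleToSlope c ε • (1 : Matrix (Fin n) (Fin n) ℝ)) := by
    simp only [Matrix.isUnit_iff_isUnit_det, isUnit_iff_ne_zero] at hu₀ ⊢
    exact ((continuous_id.matrix_det.tendsto _).comp hlim3).eventually_ne hu₀
  have h3 := eventually_negIndex_eq hlim3 (hA₀.sub hS)
    (by filter_upwards [hAh] with s h1 using h1.sub hS) (by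
    filter_upwards [hu₁] with s hs
    rw [rank_of_isUnit _ hs, rank_of_isUnit _ hu₀])
  -- Subtracting the formulas for `comparativeIndex` and `ell` cancels the index of `graphMatrix c
  -- (Y s)`, the only one not known to be locally constant.
  filter_upwards [hT, hYu, hZu, h1, h2, h3] with s hs hsY hsZ h1 h2 h3
  have e1 := comparativeIndex_add_negIndex (hY s hs) (hZ s hs) hsY hsZ
  have e2 := comparativeIndex_add_negIndex (hY t₀ ht₀) (hZ t₀ ht₀) hcY hcZ
  have e3 := ell_add_negIndex hc hε (hY s hs) hsY
  have e4 := ell_add_negIndex hc hε (hY t₀ ht₀) hcY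
  omega

/-! ### Partitions -/

section Partition

variable {a b : ℝ} {p : ℕ} {t : Fin (p + 1) → ℝ}

/-- A function on the line whose increment over each subinterval `[t_k, t_{k+1}]` is that
of `m k`. -/
def primitive (t : Fin (p + 1) → ℝ) (m : Fin p → ℝ → ℤ) (s : ℝ) : ℤ :=
  ∑ k : Fin p, m k (max (t k.castSucc) (min s (t k.succ)))

theorem IsPartition.primitive_sub (ht : IsPartition a b t) (m : Fin p → ℝ → ℤ) :
    primitive t m b - primitive t m a = ∑ k : Fin p, (m k (t k.succ) - m k (t k.castSucc)) := by
  rw [primitive, primitive, ← Finset.sum_sub_distrib]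
  refine Finset.sum_congr rfl fun k _ => ?_
  have h1 : t k.castSucc ≤ t k.succ := ht.strictMono.monotone k.castSucc_lt_succ.le
  have h2 : a ≤ t k.castSucc := ht.first ▸ ht.strictMono.monotone (Fin.zero_le _)
  have h3 : t k.succ ≤ b := ht.last ▸ ht.strictMono.monotone (Fin.le_last _)
  rw [min_eq_right h3, max_eq_right h1, min_eq_left (h2.trans h1), max_eq_left h2]

/-- For `j ≠ k` the point is clamped to the same endpoint of the `j`-th interval throughout the
`k`-th, so only the `k`-th summand varies. -/
theorem IsPartition.primitive_sub_of_mem (ht : IsPartition a b t) (m : Fin p → ℝ → ℤ) (k : Fin p)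
    {x y : ℝ} (hx : x ∈ Set.Icc (t k.castSucc) (t k.succ))
    (hy : y ∈ Set.Icc (t k.castSucc) (t k.succ)) :
    primitive t m y - primitive t m x = m k y - m k x := by
  rw [primitive, primitive, ← Finset.sum_sub_distrib, Finset.sum_eq_single k]
  · rw [min_eq_left hx.2, min_eq_left hy.2, max_eq_right hx.1, max_eq_right hy.1]
  · intro j _ hjk
    have hj : t j.castSucc ≤ t j.succ := ht.strictMono.monotone j.castSucc_lt_succ.le
    rcases lt_or_gt_of_ne hjk with h | h
    · have h1 : t j.succ ≤ t k.castSucc := ht.strictMono.monotone (Fin.succ_le_castSucc_iff.mpr h)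
      rw [min_eq_right (h1.trans hx.1), min_eq_right (h1.trans hy.1), sub_self]
    · have h1 : t k.succ ≤ t j.castSucc := ht.strictMono.monotone (Fin.succ_le_castSucc_iff.mpr h)
      rw [max_eq_left ((min_le_left _ _).trans (hx.2.trans h1)),
        max_eq_left ((min_le_left _ _).trans (hy.2.trans h1)), sub_self]
  · simp

theorem IsPartition.exists_mem_Ico (ht : IsPartition a b t) {x : ℝ} (hx : x ∈ Set.Ico a b) :
    ∃ k : Fin p, x ∈ Set.Ico (t k.castSucc) (t k.succ) := by
  by_contra! h
  have h1 : ∀ j : Fin (p + 1), t j ≤ x := by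
    intro j
    induction j using Fin.induction with
    | zero => rw [ht.first]; exact hx.1
    | succ k ih =>
      by_contra! hlt
      exact h k ⟨ih, hlt⟩
  have h2 := h1 (Fin.last p)
  rw [ht.last] at h2
  exact absurd hx.2 (not_lt.mpr h2)

theorem IsPartition.exists_mem_Ioc (ht : IsPartition a b t) {x : ℝ} (hx : x ∈ Set.Ioc a b) :
    ∃ k : Fin p, x ∈ Set.Ioc (t k.castSucc) (t k.succ) := by
  by_contra! h
  have h1 : ∀ j : Fin (p + 1), t j < x := by
    intro j
    induction j using Fin.induction with
    | zero => rw [ht.first]; exact hx.1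
    | succ k ih =>
      by_contra! hle
      exact h k ⟨ih, hle⟩
  have h2 := h1 (Fin.last p)
  rw [ht.last] at h2
  exact absurd hx.2 (not_le.mpr h2)

/-- One-sided neighbourhoods are used because at a node the left and right sides belong to different
subintervals, with different data. -/
theorem IsPartition.exists_eventually_right (ht : IsPartition a b t) {x : ℝ}
    (hx : x ∈ Set.Ico a b) : ∃ k : Fin p, x ∈ Set.Icc (t k.castSucc) (t k.succ) ∧
      ∀ᶠ s in 𝓝[Set.Icc x b] x, s ∈ Set.Icc (t k.castSucc) (t k.succ) := by
  obtain ⟨k, hk⟩ := ht.exists_mem_Ico hx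
  refine ⟨k, Set.Ico_subset_Icc_self hk, ?_⟩
  filter_upwards [self_mem_nhdsWithin, mem_nhdsWithin_of_mem_nhds (Iio_mem_nhds hk.2)]
    with s hs hs' using ⟨hk.1.trans hs.1, le_of_lt hs'⟩

theorem IsPartition.exists_eventually_left (ht : IsPartition a b t) {x : ℝ}
    (hx : x ∈ Set.Ioc a b) : ∃ k : Fin p, x ∈ Set.Icc (t k.castSucc) (t k.succ) ∧
      ∀ᶠ s in 𝓝[Set.Icc a x] x, s ∈ Set.Icc (t k.castSucc) (t k.succ) := by
  obtain ⟨k, hk⟩ := ht.exists_mem_Ioc hx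
  refine ⟨k, Set.Ioc_subset_Icc_self hk, ?_⟩
  filter_upwards [self_mem_nhdsWithin, mem_nhdsWithin_of_mem_nhds (Ioi_mem_nhds hk.1)]
    with s hs hs' using ⟨le_of_lt hs', hs.2.trans hk.2⟩

theorem IsPartition.Icc_subset (ht : IsPartition a b t) (k : Fin p) :
    Set.Icc (t k.castSucc) (t k.succ) ⊆ Set.Icc a b := by
  refine Set.Icc_subset_Icc ?_ ?_
  · rw [← ht.first]; exact ht.strictMono.monotone (Fin.zero_le _)
  · rw [← ht.last]; exact ht.strictMono.monotone (Fin.le_last _)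

/-- The one-sided conditions combine to continuity into the discrete space `ℤ`, and an interval is
connected. -/
theorem eq_of_eventually_eq {f : ℝ → ℤ} (hab : a ≤ b)
    (hright : ∀ x ∈ Set.Ico a b, ∀ᶠ s in 𝓝[Set.Icc x b] x, f s = f x)
    (hleft : ∀ x ∈ Set.Ioc a b, ∀ᶠ s in 𝓝[Set.Icc a x] x, f s = f x) : f b = f a := by
  have hcont : ContinuousOn f (Set.Icc a b) := by
    intro x hx
    rw [← Set.Icc_union_Icc_eq_Icc hx.1 hx.2, continuousWithinAt_union]
    constructor
    · rcases hx.1.eq_or_lt with rfl | h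
      · rw [Set.Icc_self]; exact continuousWithinAt_singleton
      · exact tendsto_const_nhds.congr' ((hleft x ⟨h, hx.2⟩).mono fun _ h => h.symm)
    · rcases hx.2.eq_or_lt with rfl | h
      · rw [Set.Icc_self]; exact continuousWithinAt_singleton
      · exact tendsto_const_nhds.congr' ((hright x ⟨hx.1, h⟩).mono fun _ h => h.symm)
  exact isPreconnected_Icc.constant hcont (Set.right_mem_Icc.mpr hab) (Set.left_mem_Icc.mpr hab)

theorem exists_partition {γ : Type*} (hab : a < b) {P : γ → ℝ → Prop}
    (h : ∀ x ∈ Set.Icc a b, ∃ c, ∀ᶠ s in 𝓝[Set.Icc a b] x, P c s) :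
    ∃ (p : ℕ) (t : Fin (p + 1) → ℝ) (c : Fin p → γ), IsPartition a b t ∧
      ∀ k, ∀ s ∈ Set.Icc (t k.castSucc) (t k.succ), P (c k) s := by
  have h' : ∀ x : Set.Icc a b, ∃ (c : γ) (u : Set ℝ), IsOpen u ∧ (x : ℝ) ∈ u ∧
      ∀ s ∈ u ∩ Set.Icc a b, P c s := by
    intro x
    obtain ⟨c, hc⟩ := h x x.2
    obtain ⟨u, hu, hxu, hsub⟩ := mem_nhdsWithin.mp hc
    exact ⟨c, u, hu, hxu, hsub⟩
  choose c u hu hxu hP using h'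
  obtain ⟨δ, hδ, hball⟩ := lebesgue_number_lemma_of_metric isCompact_Icc hu
    (fun x hx => Set.mem_iUnion.mpr ⟨⟨x, hx⟩, hxu ⟨x, hx⟩⟩)
  -- With `N + 1` equal pieces the mesh is below the Lebesgue number `δ`, so each piece lies in the
  -- ball about its left endpoint.
  obtain ⟨N, hN⟩ := exists_nat_gt ((b - a) / δ)
  have hN0 : (0 : ℝ) < N + 1 := by positivity
  have hstep : (b - a) / (N + 1) < δ := by
    rw [div_lt_iff₀ hδ] at hN
    rw [div_lt_iff₀ hN0]
    nlinarith
  have hstep0 : 0 < (b - a) / (N + 1) := div_pos (sub_pos.mpr hab) hN0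
  let t : Fin (N + 1 + 1) → ℝ := fun k => a + k * ((b - a) / (N + 1))
  have ht : IsPartition a b t := by
    refine ⟨?_, by simp [t], ?_⟩
    · intro i j hij
      have : ((i : ℕ) : ℝ) < (j : ℕ) := by exact_mod_cast hij
      simp only [t]
      nlinarith
    · simp only [t, Fin.val_last]
      push_cast
      field_simp
      ring
  have hmem : ∀ k : Fin (N + 1), t k.castSucc ∈ Set.Icc a b := fun k =>
    ht.Icc_subset k ⟨le_rfl, ht.strictMono.monotone k.castSucc_lt_succ.le⟩
  choose i hi using fun k : Fin (N + 1) => hball (t k.castSucc) (hmem k)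
  refine ⟨N + 1, t, fun k => c (i k), ht, fun k s hs => hP _ _ ⟨hi k ?_, ht.Icc_subset k hs⟩⟩
  have h1 : t k.succ = t k.castSucc + (b - a) / (N + 1) := by
    simp only [t, Fin.val_succ, Fin.val_castSucc]
    push_cast
    ring
  rw [Metric.mem_ball, Real.dist_eq, abs_of_nonneg (sub_nonneg.mpr hs.1)]
  linarith [hs.2]

end Partition

/-! ### Comparison of the two sums -/

theorem transpose_mul_canonicalJ_mul {R : Matrix (Fin n ⊕ Fin n) (Fin n ⊕ Fin n) ℝ}
    (hR : R ∈ Matrix.symplecticGroup (Fin n) ℝ) : Rᵀ * canonicalJ n * R = canonicalJ n := by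
  have hJ : canonicalJ n = -Matrix.J (Fin n) ℝ := by
    rw [canonicalJ, Matrix.J, fromBlocks_neg]; simp
  rw [hJ, Matrix.mul_neg, Matrix.neg_mul, SymplecticGroup.mem_iff'.mp hR]

theorem isLagrangian_vertical : IsLagrangian (vertical n) := by
  constructor
  · change wronskian (vertical n) (vertical n) = 0
    rw [wronskian_eq]
    simp [vertical, upper, lower]
  · rw [← rank_transpose_mul_self, transpose_mul_self_eq]
    simp [vertical, upper, lower]

theorem isLagrangian_mul_vertical {R : Matrix (Fin n ⊕ Fin n) (Fin n ⊕ Fin n) ℝ}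
    (hR : R ∈ Matrix.symplecticGroup (Fin n) ℝ) : IsLagrangian (R * vertical n) := by
  constructor
  · calc (R * vertical n)ᵀ * canonicalJ n * (R * vertical n)
        = (vertical n)ᵀ * (Rᵀ * canonicalJ n * R) * vertical n := by
          rw [transpose_mul]; simp only [Matrix.mul_assoc]
      _ = 0 := by rw [transpose_mul_canonicalJ_mul hR, isLagrangian_vertical.1]
  · rw [rank_mul_eq_right_of_isUnit_det _ _ (SymplecticGroup.symplectic_det hR),
      isLagrangian_vertical.2]

theorem oscSum_eq_maslovSum {a b : ℝ} (hab : a < b)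
    {Y : ℝ → Matrix (Fin n ⊕ Fin n) (Fin n) ℝ} (hY : IsLagrangianPath a b Y)
    {p q : ℕ} {t : Fin (p + 1) → ℝ}
    {R : Fin p → ℝ → Matrix (Fin n ⊕ Fin n) (Fin n ⊕ Fin n) ℝ} (hR : IsOscSystem a b Y t R)
    {τ : Fin (q + 1) → ℝ} {ε : Fin q → ℝ}
    (hε : IsMaslovSystem a b (fun _ => vertical n) Y τ ε) :
    oscSum Y t R = maslovSum (fun _ => vertical n) Y τ ε := by
  have ht := hR.isPartition
  have hτ := hε.isPartition
  let m : Fin p → ℝ → ℤ := fun k s => (comparativeIndex (Y s) (R k s * vertical n) : ℤ)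
  let l : Fin q → ℝ → ℤ := fun j s => (ell (vertical n) (Y s) (ε j) : ℤ)
  have key : ∀ (k : Fin p) (j : Fin q) (x : ℝ) (K : Set ℝ),
      x ∈ Set.Icc (t k.castSucc) (t k.succ) → x ∈ Set.Icc (τ j.castSucc) (τ j.succ) →
      (∀ᶠ s in 𝓝[K] x, s ∈ Set.Icc (t k.castSucc) (t k.succ)) →
      (∀ᶠ s in 𝓝[K] x, s ∈ Set.Icc (τ j.castSucc) (τ j.succ)) →
      ∀ᶠ s in 𝓝[K] x, primitive t m s - primitive τ l s = primitive t m x - primitive τ l x := by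
    intro k j x K hxk hxj hk hj
    set T := Set.Icc (t k.castSucc) (t k.succ) with hT
    have hsub := ht.Icc_subset k
    have hloc := eventually_comparativeIndex_sub_ell_eq (T := T) (ε := ε j) hxk
      (hY.continuousOn.mono hsub)
      (Z := fun s => R k s * vertical n)
      ((continuous_id.matrix_mul continuous_const).comp_continuousOn (hR.continuousOn k))
      (fun s hs => hY.isLagrangian s (hsub hs))
      (fun s hs => isLagrangian_mul_vertical (hR.symplectic k s (hsub hs)))
      (hR.rank_wronskian k) (hR.rank_upper k) (hε.mem_Ioo j) (hε.isUnit_plus j x hxj)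
    -- The local comparison is relative to one subinterval of `t`; it transfers to `K`, which
    -- eventually lies inside that subinterval.
    have hle : 𝓝[K] x ≤ 𝓝[T] x := le_inf nhdsWithin_le_nhds (le_principal_iff.mpr hk)
    filter_upwards [hle hloc, hk, hj] with s hs hsk hsj
    have h1 := ht.primitive_sub_of_mem m k hxk hsk
    have h2 := hτ.primitive_sub_of_mem l j hxj hsj
    simp only [m, l] at h1 h2 ⊢
    linarith
  have hconst := eq_of_eventually_eq (f := fun s => primitive t m s - primitive τ l s) hab.le
    (fun x hx => by
      obtain ⟨k, hxk, hk⟩ := ht.exists_eventually_right hx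
      obtain ⟨j, hxj, hj⟩ := hτ.exists_eventually_right hx
      exact key k j x _ hxk hxj hk hj)
    (fun x hx => by
      obtain ⟨k, hxk, hk⟩ := ht.exists_eventually_left hx
      obtain ⟨j, hxj, hj⟩ := hτ.exists_eventually_left hx
      exact key k j x _ hxk hxj hk hj)
  have h1 := ht.primitive_sub m
  have h2 := hτ.primitive_sub l
  rw [oscSum, maslovSum, ← h1, ← h2]
  linarith

/-! ### Existence of admissible choices -/

theorem exists_isOscSystem {a b : ℝ} (hab : a < b)
    {Y : ℝ → Matrix (Fin n ⊕ Fin n) (Fin n) ℝ} (hY : IsLagrangianPath a b Y) :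
    ∃ (p : ℕ) (t : Fin (p + 1) → ℝ)
      (R : Fin p → ℝ → Matrix (Fin n ⊕ Fin n) (Fin n ⊕ Fin n) ℝ), IsOscSystem a b Y t R := by
  obtain ⟨p, t, c, ht, hc⟩ := exists_partition (P := fun c s => IsUnit (shearLower c (Y s))) hab
    (fun x hx => by
      obtain ⟨c, -, hc, -⟩ := exists_pos_isUnit_shearLower (hY.isLagrangian x hx)
        (hY.isLagrangian x hx)
      exact ⟨c, (hY.continuousOn x hx).eventually (eventually_isUnit_shearLower hc)⟩)
  -- A constant symplectic matrix taking the vertical plane to `{U = -cX}`: then `W(R E, Y) = U +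
  -- cX` is invertible on the subinterval and the upper block of `R E` is `I`, so both ranks are
  -- `n`.
  let R : ℝ → Matrix (Fin n ⊕ Fin n) (Fin n ⊕ Fin n) ℝ := fun c => fromBlocks 0 1 (-1) (-c • 1)
  have hRE : ∀ c, R c * vertical n = fromRows 1 (-c • 1) := by
    intro c
    simp [R, vertical, fromBlocks_mul_fromRows]
  refine ⟨p, t, fun k _ => R (c k), ht, ?_, fun k => continuousOn_const, ?_, ?_⟩
  · intro k s _
    rw [SymplecticGroup.mem_iff]
    simp [R, Matrix.J, fromBlocks_transpose, fromBlocks_multiply]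
  · intro k
    refine ⟨n, fun s hs => ?_⟩
    have h1 : wronskian (R (c k) * vertical n) (Y s) = shearLower (c k) (Y s) := by
      rw [wronskian_eq, hRE]
      simp [upper, lower, shearLower]
    rw [h1, rank_of_isUnit _ (hc k s hs), Fintype.card_fin]
  · intro k
    refine ⟨n, fun s _ => ?_⟩
    rw [hRE]
    simp [upper]

theorem exists_isMaslovSystem {a b : ℝ} (hab : a < b)
    {Y : ℝ → Matrix (Fin n ⊕ Fin n) (Fin n) ℝ} (hY : IsLagrangianPath a b Y) :
    ∃ (p : ℕ) (t : Fin (p + 1) → ℝ) (ε : Fin p → ℝ),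
      IsMaslovSystem a b (fun _ => vertical n) Y t ε := by
  obtain ⟨p, t, ε, ht, hε⟩ := exists_partition
    (P := fun ε s => ε ∈ Set.Ioo 0 Real.pi ∧ IsUnit (GamShift (vertical n) (Y s) ε) ∧
      IsUnit (GamShift (vertical n) (Y s) (-ε))) hab
    (fun x hx => by
      obtain ⟨c, hc, hc1, hc2⟩ := (hY.isLagrangian x hx).exists_pos_isUnit_shearLower_neg
      -- Chosen so that `cot (ε/2) = c`; then `rotUpper` at `±ε` is a nonzero multiple of `U ∓ cX`.
      set ε := 2 * Real.arctan c⁻¹ with hε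
      have hε2 : ε / 2 = Real.arctan c⁻¹ := by rw [hε]; ring
      have hsin : Real.sin (ε / 2) ≠ 0 := by
        rw [hε2, Real.sin_arctan]
        positivity
      have hcos : Real.cos (ε / 2) = c * Real.sin (ε / 2) := by
        rw [hε2, Real.sin_arctan, Real.cos_arctan]
        field_simp
      have hplus : ∀ Z : Matrix (Fin n ⊕ Fin n) (Fin n) ℝ,
          rotUpper ε Z = (-Real.sin (ε / 2)) • shearLower (-c) Z := by
        intro Z
        rw [rotUpper, shearLower, hcos]
        module
      have hminus : ∀ Z : Matrix (Fin n ⊕ Fin n) (Fin n) ℝ,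
          rotUpper (-ε) Z = Real.sin (ε / 2) • shearLower c Z := by
        intro Z
        rw [rotUpper, shearLower, neg_div, Real.cos_neg, Real.sin_neg, hcos]
        module
      have hsmul : ∀ (r : ℝ) (M : Matrix (Fin n) (Fin n) ℝ), r ≠ 0 → IsUnit M → IsUnit (r • M) := by
        intro r M hr hM
        rw [Matrix.isUnit_iff_isUnit_det, det_smul]
        exact ((isUnit_iff_ne_zero.mpr hr).pow _).mul ((Matrix.isUnit_iff_isUnit_det _).mp hM)
      refine ⟨ε, ?_⟩
      filter_upwards [self_mem_nhdsWithin,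
        (hY.continuousOn x hx).eventually (eventually_isUnit_shearLower hc1),
        (hY.continuousOn x hx).eventually (eventually_isUnit_shearLower hc2)] with s hs h1 h2
      refine ⟨⟨?_, ?_⟩, ?_, ?_⟩
      · have : 0 < Real.arctan c⁻¹ := Real.arctan_pos.mpr (inv_pos.mpr hc)
        linarith
      · linarith [Real.arctan_lt_pi_div_two c⁻¹]
      · rw [isUnit_GamShift_iff (hY.isLagrangian s hs), hplus]
        exact hsmul _ _ (neg_ne_zero.mpr hsin) h2
      · rw [isUnit_GamShift_iff (hY.isLagrangian s hs), hminus]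
        exact hsmul _ _ hsin h1)
  refine ⟨p, t, ε, ht, fun k => ?_, fun k s hs => (hε k s hs).2.1, fun k s hs => (hε k s hs).2.2⟩
  exact (hε k _ (Set.left_mem_Icc.mpr (ht.strictMono.monotone k.castSucc_lt_succ.le))).1

end

end LagrangianPaths

theorem corollaryC (n : ℕ) (a b : ℝ) (hab : a < b)
    (Y : ℝ → Matrix (Fin n ⊕ Fin n) (Fin n) ℝ)
    (hY : LagrangianPaths.IsLagrangianPath a b Y) :
    LagrangianPaths.IsOscillationNumber a b Y (LagrangianPaths.oscillationNumber a b Y) ∧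
    LagrangianPaths.IsMaslovIndex a b (fun _ => LagrangianPaths.vertical n) Y
      (LagrangianPaths.maslovIndex a b (fun _ => LagrangianPaths.vertical n) Y) ∧
    LagrangianPaths.oscillationNumber a b Y =
      LagrangianPaths.maslovIndex a b (fun _ => LagrangianPaths.vertical n) Y := by
  obtain ⟨p, t, R, hR⟩ := LagrangianPaths.exists_isOscSystem hab hY
  obtain ⟨q, τ, ε, hε⟩ := LagrangianPaths.exists_isMaslovSystem hab hY
  -- The fixed Maslov system supplies the common value of all oscillation sums; below, the fixed
  -- oscillation system does the same for the Maslov sums.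
  have hosc : ∃ N, LagrangianPaths.IsOscillationNumber a b Y N :=
    ⟨_, ⟨p, t, R, hR⟩, fun _ _ _ h => LagrangianPaths.oscSum_eq_maslovSum hab hY h hε⟩
  have hmas : ∃ m, LagrangianPaths.IsMaslovIndex a b (fun _ => LagrangianPaths.vertical n) Y m :=
    ⟨_, ⟨q, τ, ε, hε⟩, fun _ _ _ h => (LagrangianPaths.oscSum_eq_maslovSum hab hY hR h).symm⟩
  have h1 : LagrangianPaths.IsOscillationNumber a b Y
      (LagrangianPaths.oscillationNumber a b Y) := by
    rw [LagrangianPaths.oscillationNumber, dif_pos hosc]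
    exact hosc.choose_spec
  have h2 : LagrangianPaths.IsMaslovIndex a b (fun _ => LagrangianPaths.vertical n) Y
      (LagrangianPaths.maslovIndex a b (fun _ => LagrangianPaths.vertical n) Y) := by
    rw [LagrangianPaths.maslovIndex, dif_pos hmas]
    exact hmas.choose_spec
  refine ⟨h1, h2, ?_⟩
  rw [← h1.2 p t R hR, ← h2.2 q τ ε hε]
  exact LagrangianPaths.oscSum_eq_maslovSum hab hY hR hε
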